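/- Let $\Omega\subset\mathbb{R}^3$ be a nonempty bounded open set (for instance a bounded regular domain), $a>0$ and $2<\gamma<4$. Let $H_0^1(\Omega)$ be the closure of $C_c^\infty(\Omega)$ in $H^1(\Omega)$, and write $\|u\|=(\int_\Omega|\nabla u|^2)^{1/2}$ and $\|u\|_\gamma=(\int_\Omega|u|^\gamma)^{1/\gamma}$. For $\lambda>0$ and $u\in H_0^1(\Omega)$ put $$\Phi_\lambda(u)=\frac a2\|u\|^2+\frac\lambda4\|u\|^4-\frac1\gamma\|u\|_\gamma^\gamma ,\qquad \psi_{\lambda,u}(t)=\Phi_\lambda(tu)\quad(t>0),$$ and for $u\neq0$ $$\lambda(u)=C_{a,\gamma}\Big(\frac{\|u\|_\gamma}{\|u\|}\Big)^{\frac{2\gamma}{\gamma-2}},\quad C_{a,\gamma}=a\,\frac{\gamma-2}{4-\gamma}\Big(\frac{4-\gamma}{2a}\Big)^{\frac2{\gamma-2}},\qquad \lambda_0(u)=2\Big(\frac2\gamma\Big)^{\frac2{\gamma-2}}\lambda(u),\qquad t(u)=\Big(\frac{2a}{4-\gamma}\frac{\|u\|^2}{\|u\|_\gamma^\gamma}\Big)^{\frac1{\gamma-2}}.$$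 Let $\lambda^*=\sup_{u\ne0}\lambda(u)$ and $\lambda_0^*=\sup_{u\ne0}\lambda_0(u)$ (suprema over $u\in H_0^1(\Omega)\setminus\{0\}$, a priori in $[0,\infty]$), and let $S_\gamma=\inf_{u\neq0}\|u\|/\|u\|_\gamma$ be the best constant of the embedding $H_0^1(\Omega)\hookrightarrow L^\gamma(\Omega)$. Then: 1. For every $u\in H_0^1(\Omega)\setminus\{0\}$, $(t(u),\lambda(u))$ is the unique pair $(t,\lambda)\in(0,\infty)^2$ with $\psi_{\lambda,u}'(t)=\psi_{\lambda,u}''(t)=0$; and there is exactly one pair $(t,\lambda)\in(0,\infty)^2$ with $\psi_{\lambda,u}(t)=\psi_{\lambda,u}'(t)=0$, and its second entry is $\lambda_0(u)$. 2. $0<S_\gamma<\infty$ and $\lambda^*=C_{a,\gamma}\,S_\gamma^{\frac{2\gamma}{2-\gamma}}$. 3. $\lambda_0^*<\lambda^*<\infty$. 4. There is $u\in H_0^1(\Omega)\setminus\{0\}$ with $\lambda(u)=\lambda^*$ and $\lambda_0(u)=\lambda_0^*$. -/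

import Mathlib

open MeasureTheory
open scoped ContDiff ENNReal

noncomputable section

namespace Kirchhoff

/-- Euclidean space `ℝ³`. -/
abbrev E3 : Type := EuclideanSpace ℝ (Fin 3)

/-- `φ ∈ C_c^∞(Ω)`: a smooth function whose support is a compact subset of `Ω`. -/
structure IsTestFunction (Ω : Set E3) (φ : E3 → ℝ) : Prop where
  smooth : ContDiff ℝ ∞ φ
  compact : HasCompactSupport φ
  subset : tsupport φ ⊆ Ω

/-- The Hilbert space `L²(Ω) × L²(Ω; ℝ³)` with norm `(‖u‖² + ‖g‖²)^{1/2}`. On pairs `(u, ∇u)` this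
is the full `H¹` norm. -/
abbrev L2Pair (Ω : Set E3) : Type :=
  WithLp 2 (Lp ℝ 2 (volume.restrict Ω) × Lp E3 2 (volume.restrict Ω))

/-- `g` is the distributional gradient of `u` on `Ω`. -/
def HasWeakGradient (Ω : Set E3) (u : E3 → ℝ) (g : E3 → E3) : Prop :=
  ∀ φ : E3 → ℝ, IsTestFunction Ω φ → ∀ v : E3,
    ∫ x in Ω, u x * fderiv ℝ φ x v = - ∫ x in Ω, φ x * inner ℝ v (g x)

/-- The space of test functions `C_c^∞(Ω)`, each `φ` being represented by the pair `(φ, ∇φ)`. -/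
def testPairs (Ω : Set E3) : Submodule ℝ (L2Pair Ω) where
  carrier := {p | ∃ φ : E3 → ℝ, IsTestFunction Ω φ ∧
    p.fst =ᵐ[volume.restrict Ω] φ ∧ p.snd =ᵐ[volume.restrict Ω] gradient φ}
  zero_mem' := by
    refine ⟨0, ⟨contDiff_const, HasCompactSupport.zero, by simp⟩, ?_, ?_⟩
    · exact Lp.coeFn_zero _ _ _
    · have h : gradient (0 : E3 → ℝ) = 0 := by
        funext x; simp [gradient]
      rw [h]; exact Lp.coeFn_zero _ _ _
  add_mem' := by
    rintro p q ⟨φ, hφ, hp1, hp2⟩ ⟨ψ, hψ, hq1, hq2⟩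
    refine ⟨φ + ψ, ⟨hφ.smooth.add hψ.smooth, hφ.compact.add hψ.compact, ?_⟩, ?_, ?_⟩
    · exact (tsupport_add φ ψ).trans (Set.union_subset hφ.subset hψ.subset)
    · exact (Lp.coeFn_add _ _).trans (hp1.add hq1)
    · have h : gradient (φ + ψ) = gradient φ + gradient ψ := by
        funext x
        have h1 : DifferentiableAt ℝ φ x := (hφ.smooth.differentiable (by simp)) x
        have h2 : DifferentiableAt ℝ ψ x := (hψ.smooth.differentiable (by simp)) x
        simp [gradient, fderiv_add h1 h2]
      rw [h]; exact (Lp.coeFn_add _ _).trans (hp2.add hq2)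
  smul_mem' := by
    rintro c p ⟨φ, hφ, hp1, hp2⟩
    refine ⟨c • φ, ⟨contDiff_const.smul hφ.smooth, hφ.compact.smul_left (f := fun _ => c), ?_⟩,
      ?_, ?_⟩
    · exact (tsupport_smul_subset_right (fun _ => c) φ).trans hφ.subset
    · exact (Lp.coeFn_smul _ _).trans (hp1.const_smul c)
    · have h : gradient (c • φ) = c • gradient φ := by
        funext x
        have h1 : DifferentiableAt ℝ φ x := (hφ.smooth.differentiable (by simp)) x
        simp [gradient, fderiv_const_smul h1 c]
      rw [h]; exact (Lp.coeFn_smul _ _).trans (hp2.const_smul c)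

/-- The Sobolev space `H_0^1(Ω)`: the closure of `C_c^∞(Ω)` for the `H¹` norm. An element is a pair
`(u, ∇u)`; the second entry is the weak gradient of the first one, see
`hasWeakGradient_of_mem`. -/
def H01 (Ω : Set E3) : Submodule ℝ (L2Pair Ω) := (testPairs Ω).topologicalClosure

/-- The function `u` underlying an element of `H_0^1(Ω)`. -/
def val {Ω : Set E3} (u : H01 Ω) : E3 → ℝ := (u : L2Pair Ω).fst

/-- The weak gradient of an element of `H_0^1(Ω)`. -/
def grad {Ω : Set E3} (u : H01 Ω) : E3 → E3 := (u : L2Pair Ω).snd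

/-- The second entry is the weak gradient of the first. -/
theorem hasWeakGradient_of_mem {Ω : Set E3} (u : H01 Ω) :
    HasWeakGradient Ω (val u) (grad u) := by
  intro φ hφ v
  have hφc : Continuous φ := hφ.smooth.continuous
  have hdc : Continuous (fun x => fderiv ℝ φ x v) :=
    (hφ.smooth.continuous_fderiv (by simp)).clm_apply continuous_const
  have hds : HasCompactSupport (fun x => fderiv ℝ φ x v) := by
    have := hφ.compact.fderiv (𝕜 := ℝ)
    exact this.comp_left (g := fun L : E3 →L[ℝ] ℝ => L v) (by simp)
  have m1 : MemLp (fun x => fderiv ℝ φ x v) 2 (volume.restrict Ω) :=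
    (hdc.memLp_of_hasCompactSupport hds).restrict Ω
  have m2 : MemLp (fun x => φ x • v) 2 (volume.restrict Ω) :=
    ((hφc.smul continuous_const).memLp_of_hasCompactSupport hφ.compact.smul_right).restrict Ω
  have key : ∀ p : L2Pair Ω,
      inner ℝ m1.toLp p.fst + inner ℝ m2.toLp p.snd =
      (∫ x in Ω, p.fst x * fderiv ℝ φ x v) + ∫ x in Ω, φ x * inner ℝ v (p.snd x) := by
    intro p
    rw [L2.inner_def, L2.inner_def]
    congr 1
    · refine integral_congr_ae ?_
      filter_upwards [m1.coeFn_toLp] with x hx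
      rw [hx]; simp
    · refine integral_congr_ae ?_
      filter_upwards [m2.coeFn_toLp] with x hx
      rw [hx, inner_smul_left]; simp
  have hcl : IsClosed {p : L2Pair Ω | inner ℝ m1.toLp p.fst + inner ℝ m2.toLp p.snd = (0 : ℝ)} := by
    refine isClosed_eq ?_ continuous_const
    have c1 : Continuous (fun p : L2Pair Ω => p.fst) := by fun_prop
    have c2 : Continuous (fun p : L2Pair Ω => p.snd) := by fun_prop
    exact (continuous_const.inner c1).add (continuous_const.inner c2)
  have hsub : closure (testPairs Ω : Set (L2Pair Ω)) ⊆
      {p : L2Pair Ω | inner ℝ m1.toLp p.fst + inner ℝ m2.toLp p.snd = (0 : ℝ)} := by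
    refine closure_minimal ?_ hcl
    rintro p ⟨ψ, hψ, h1, h2⟩
    have hψd : Differentiable ℝ ψ := hψ.smooth.differentiable (by simp)
    have hφd : Differentiable ℝ φ := hφ.smooth.differentiable (by simp)
    have hec : Continuous (fun x => fderiv ℝ ψ x v) :=
      (hψ.smooth.continuous_fderiv (by simp)).clm_apply continuous_const
    change _ = _
    rw [key]
    have e1 : ∫ x in Ω, p.fst x * fderiv ℝ φ x v = ∫ x, ψ x * fderiv ℝ φ x v := by
      have h : ∫ x in Ω, p.fst x * fderiv ℝ φ x v = ∫ x in Ω, ψ x * fderiv ℝ φ x v := by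
        refine integral_congr_ae ?_
        filter_upwards [h1] with x hx
        rw [hx]
      rw [h]
      refine setIntegral_eq_integral_of_forall_compl_eq_zero fun x hx => ?_
      rw [image_eq_zero_of_notMem_tsupport (fun h => hx (hψ.subset h)), zero_mul]
    have e2 : ∫ x in Ω, φ x * inner ℝ v (p.snd x) = ∫ x, fderiv ℝ ψ x v * φ x := by
      have h : ∫ x in Ω, φ x * inner ℝ v (p.snd x) = ∫ x in Ω, fderiv ℝ ψ x v * φ x := by
        refine integral_congr_ae ?_
        filter_upwards [h2] with x hx
        rw [hx, gradient, real_inner_comm, InnerProductSpace.toDual_symm_apply, mul_comm]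
      rw [h]
      refine setIntegral_eq_integral_of_forall_compl_eq_zero fun x hx => ?_
      rw [image_eq_zero_of_notMem_tsupport (fun h => hx (hφ.subset h)), mul_zero]
    have ibp : ∫ x, ψ x * fderiv ℝ φ x v = - ∫ x, fderiv ℝ ψ x v * φ x := by
      refine integral_mul_fderiv_eq_neg_fderiv_mul_of_integrable ?_ ?_ ?_
        (fun x _ => hψd x) (fun x _ => hφd x)
      · exact (hec.mul hφc).integrable_of_hasCompactSupport hφ.compact.mul_left
      · exact (hψ.smooth.continuous.mul hdc).integrable_of_hasCompactSupport hψ.compact.mul_right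
      · exact (hψ.smooth.continuous.mul hφc).integrable_of_hasCompactSupport hψ.compact.mul_right
    rw [e1, e2, ibp]; ring
  have h := hsub u.2
  have h' := key (u : L2Pair Ω)
  change inner ℝ m1.toLp _ + inner ℝ m2.toLp _ = (0 : ℝ) at h
  rw [h] at h'
  change ∫ x in Ω, (u : L2Pair Ω).fst x * _ = - ∫ x in Ω, φ x * inner ℝ v ((u : L2Pair Ω).snd x)
  linarith

/-- An element of `H_0^1(Ω)` is determined by its function: it is zero as soon as the function
vanishes almost everywhere. -/
theorem eq_zero_of_val {Ω : Set E3} (hΩ : IsOpen Ω) (u : H01 Ω)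
    (hu : val u =ᵐ[volume.restrict Ω] 0) : u = 0 := by
  have hfst : (u : L2Pair Ω).fst = 0 := by
    apply Lp.ext
    exact hu.trans (Lp.coeFn_zero _ _ _).symm
  have hmem : MemLp (grad u) 2 (volume.restrict Ω) := Lp.memLp _
  have hz : ∀ᵐ x ∂volume, x ∈ Ω → grad u x = 0 := by
    refine hΩ.ae_eq_zero_of_integral_contDiff_smul_eq_zero ?_ ?_
    · rw [locallyIntegrableOn_iff hΩ.isLocallyClosed]
      intro k hk hkc
      have : IsFiniteMeasure (volume.restrict k : Measure E3) :=
        ⟨by simpa using hkc.measure_lt_top⟩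
      have hm : MemLp (grad u) 2 (volume.restrict k) :=
        hmem.mono_measure (Measure.restrict_mono hk le_rfl)
      exact hm.integrable (by norm_num)
    · intro φ hφs hφc hφΩ
      have hφ : IsTestFunction Ω φ := ⟨hφs, hφc, hφΩ⟩
      have m : MemLp φ 2 (volume.restrict Ω) :=
        (hφs.continuous.memLp_of_hasCompactSupport hφc).restrict Ω
      have hint : Integrable (fun x => φ x • grad u x) (volume.restrict Ω) :=
        memLp_one_iff_integrable.1 (hmem.smul (r := 1) m)
      have e : ∫ x, φ x • grad u x = ∫ x in Ω, φ x • grad u x := by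
        refine (setIntegral_eq_integral_of_forall_compl_eq_zero fun x hx => ?_).symm
        rw [image_eq_zero_of_notMem_tsupport (fun h => hx (hφΩ h)), zero_smul]
      rw [e]
      refine ext_inner_left ℝ fun v => ?_
      rw [← integral_inner hint v, inner_zero_right]
      have h := hasWeakGradient_of_mem u φ hφ v
      have h0 : ∫ x in Ω, val u x * fderiv ℝ φ x v = 0 := by
        rw [integral_eq_zero_of_ae]
        filter_upwards [hu] with x hx
        simp [hx]
      rw [h0] at h
      simp only [inner_smul_right]
      linarith
  have hsnd : (u : L2Pair Ω).snd = 0 := by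
    apply Lp.ext
    refine Filter.EventuallyEq.trans ?_ (Lp.coeFn_zero _ _ _).symm
    exact (ae_restrict_iff' hΩ.measurableSet).2 hz
  apply Subtype.ext
  exact (WithLp.ofLp_injective 2) (Prod.ext hfst hsnd)

/-- The norm `‖u‖ = (∫_Ω |∇u|²)^{1/2}` of `H_0^1(Ω)`. -/
def gradNorm {Ω : Set E3} (u : H01 Ω) : ℝ≥0∞ := eLpNorm (grad u) 2 (volume.restrict Ω)

/-- The norm `‖u‖_γ = (∫_Ω |u|^γ)^{1/γ}`, a priori possibly infinite. -/
def gammaNorm {Ω : Set E3} (γ : ℝ) (u : H01 Ω) : ℝ≥0∞ :=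
  eLpNorm (val u) (ENNReal.ofReal γ) (volume.restrict Ω)

/-- The energy functional
`Φ_l(u) = (a/2) ∫ |∇u|² + (l/4) (∫ |∇u|²)² - (1/γ) ∫ |u|^γ`. -/
def energy {Ω : Set E3} (a γ l : ℝ) (u : H01 Ω) : ℝ :=
  a / 2 * (∫ x in Ω, ‖grad u x‖ ^ 2) + l / 4 * (∫ x in Ω, ‖grad u x‖ ^ 2) ^ 2
    - 1 / γ * ∫ x in Ω, |val u x| ^ γ

/-- The fiber map `ψ_{l,u}(t) = Φ_l(t u)`. -/
def fiber {Ω : Set E3} (a γ l : ℝ) (u : H01 Ω) (t : ℝ) : ℝ := energy a γ l (t • u)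

/-- The constant `C_{a,γ}`. -/
def constC (a γ : ℝ) : ℝ :=
  a * ((γ - 2) / (4 - γ)) * ((4 - γ) / (2 * a)) ^ (2 / (γ - 2))

/-- The constant `C_{0,a,γ}`. -/
def constC0 (γ : ℝ) : ℝ := 2 * (2 / γ) ^ (2 / (γ - 2))

/-- `λ(u) = C_{a,γ} (‖u‖_γ / ‖u‖)^{2γ/(γ-2)}`. -/
def lam {Ω : Set E3} (a γ : ℝ) (u : H01 Ω) : ℝ≥0∞ :=
  ENNReal.ofReal (constC a γ) * (gammaNorm γ u / gradNorm u) ^ (2 * γ / (γ - 2))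

/-- `λ₀(u) = C_{0,a,γ} λ(u)`. -/
def lam0 {Ω : Set E3} (a γ : ℝ) (u : H01 Ω) : ℝ≥0∞ :=
  ENNReal.ofReal (constC0 γ) * lam a γ u

/-- `t(u) = ((2a/(4-γ)) ‖u‖² / ‖u‖_γ^γ)^{1/(γ-2)}`. -/
def tOf {Ω : Set E3} (a γ : ℝ) (u : H01 Ω) : ℝ :=
  (2 * a / (4 - γ) * ((∫ x in Ω, ‖grad u x‖ ^ 2) / ∫ x in Ω, |val u x| ^ γ)) ^ (1 / (γ - 2))

/-- The extremal parameter `λ* = sup {λ(u) : u ∈ H_0^1(Ω), u ≠ 0}`. -/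
def lamStar (Ω : Set E3) (a γ : ℝ) : ℝ≥0∞ := ⨆ u : {u : H01 Ω // u ≠ 0}, lam a γ u.1

/-- The parameter `λ₀* = sup {λ₀(u) : u ∈ H_0^1(Ω), u ≠ 0}`. -/
def lam0Star (Ω : Set E3) (a γ : ℝ) : ℝ≥0∞ := ⨆ u : {u : H01 Ω // u ≠ 0}, lam0 a γ u.1

/-- The best constant `S_γ = inf {‖u‖ / ‖u‖_γ : u ∈ H_0^1(Ω), u ≠ 0}` of the embedding of
`H_0^1(Ω)` in `L^γ(Ω)`, that is the largest `S` with `S ‖u‖_γ ≤ ‖u‖` for all `u`. -/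
def bestConst (Ω : Set E3) (γ : ℝ) : ℝ≥0∞ :=
  ⨅ u : {u : H01 Ω // u ≠ 0}, gradNorm u.1 / gammaNorm γ u.1

end Kirchhoff

end

noncomputable section

namespace Kirchhoff

open Filter Topology

/-! For fixed `u ≠ 0` put `A = ‖u‖²` and `G = ‖u‖_γ^γ`. On `t > 0` the fiber map is `(a/2) A t² +
(l/4) A² t⁴ - (1/γ) G t^γ`. In each of the two systems the unknown `l` can be eliminated linearly,
which leaves an equation for `t^(γ-2)` with one positive solution; `l` is then determined
(`critical_system_iff`, `zero_system_iff`). Both resulting values of `l` are constants times the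
same power of `‖u‖_γ / ‖u‖`, and their ratio `constC0 γ` is below 1 by Bernoulli's inequality
(`constC0_lt_one`).

Since the exponent `2γ/(γ-2)` is positive, maximizing `λ(u)`, maximizing `λ₀(u)` and minimizing `‖u‖
/ ‖u‖_γ` are one and the same problem. Everything else follows once `‖u‖_γ / ‖u‖` has a maximizer
(`exists_maximizer`): there the quotient is positive and finite, so both suprema and the best
constant can be read off, and `λ₀* = constC0 γ · λ* < λ*`.

The maximizer comes from the direct method. Rellich's theorem is obtained by comparing test
functions with their ball averages, uniformly in terms of the gradient, while weak convergence makes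
the averages converge strongly. Interpolation with the Sobolev inequality carries compactness from
`L²` to `L^γ`. In `exists_maximizer_of_compact` the parallelogram law makes a maximizing sequence
converge in norm. -/

/-! ### Translations and averages of `C¹` functions in `L²`. -/

/-- Cauchy–Schwarz against the constant 1, whose `L²` norm is 1 for a probability measure. -/
theorem sq_lintegral_le_lintegral_sq {α : Type*} [MeasurableSpace α] (μ : Measure α)
    [IsProbabilityMeasure μ] {f : α → ℝ≥0∞} (hf : AEMeasurable f μ) :
    (∫⁻ x, f x ∂μ) ^ 2 ≤ ∫⁻ x, f x ^ 2 ∂μ := by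
  have h := ENNReal.lintegral_mul_le_Lp_mul_Lq μ Real.HolderConjugate.two_two hf
    (aemeasurable_const (b := (1 : ℝ≥0∞)))
  simp only [Pi.mul_apply, mul_one, ENNReal.rpow_two, one_pow, lintegral_const, measure_univ,
    ENNReal.one_rpow] at h
  calc (∫⁻ x, f x ∂μ) ^ 2 ≤ ((∫⁻ x, f x ^ 2 ∂μ) ^ (1 / 2 : ℝ)) ^ 2 := by gcongr
    _ = _ := by rw [← ENNReal.rpow_natCast, ← ENNReal.rpow_mul]; norm_num

theorem enorm_integral_sq_le {α : Type*} [MeasurableSpace α] (μ : Measure α)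
    [IsProbabilityMeasure μ] {f : α → ℝ} (hf : AEStronglyMeasurable f μ) :
    ‖∫ x, f x ∂μ‖ₑ ^ 2 ≤ ∫⁻ x, ‖f x‖ₑ ^ 2 ∂μ :=
  (by gcongr; exact enorm_integral_le_lintegral_enorm f :
    ‖∫ x, f x ∂μ‖ₑ ^ 2 ≤ (∫⁻ x, ‖f x‖ₑ ∂μ) ^ 2).trans
      (sq_lintegral_le_lintegral_sq μ hf.enorm)

/-- The `L²` modulus of continuity of a `C¹` function is controlled by its derivative. -/
theorem lintegral_enorm_translate_sub_sq_le {u : E3 → ℝ} (hu : ContDiff ℝ 1 u) (z : E3) :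
    ∫⁻ x, ‖u (x + z) - u x‖ₑ ^ 2 ≤ ‖z‖ₑ ^ 2 * ∫⁻ x, ‖fderiv ℝ u x‖ₑ ^ 2 := by
  have hd : Continuous (fderiv ℝ u) := hu.continuous_fderiv (by simp)
  -- The unit interval is a probability space, so the fundamental theorem of calculus along the
  -- segment from `x` to `x + z` writes the increment as an average, to which `enorm_integral_sq_le`
  -- applies.
  let ν : Measure ℝ := volume.restrict (Set.Ioc 0 1)
  have : IsProbabilityMeasure ν := ⟨by simp [ν]⟩
  have key : ∀ x, u (x + z) - u x = ∫ t, fderiv ℝ u (x + t • z) z ∂ν := by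
    intro x
    have h := intervalIntegral.integral_eq_sub_of_hasDerivAt (a := 0) (b := 1)
      (f := fun t : ℝ => u (x + t • z)) (f' := fun t => fderiv ℝ u (x + t • z) z) ?_ ?_
    · rw [intervalIntegral.integral_of_le zero_le_one] at h
      simpa using h.symm
    · intro t _
      have h1 : HasDerivAt (fun t : ℝ => x + t • z) z t := by
        simpa using ((hasDerivAt_id t).smul_const z).const_add x
      exact ((hu.differentiable (by simp)) _).hasFDerivAt.comp_hasDerivAt t h1
    · exact Continuous.intervalIntegrable (by fun_prop) _ _
  have hm : Measurable (fun p : E3 × ℝ => ‖fderiv ℝ u (p.1 + p.2 • z)‖ₑ ^ 2) := by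
    have : Continuous (fun p : E3 × ℝ => fderiv ℝ u (p.1 + p.2 • z)) := by fun_prop
    exact this.enorm.measurable.pow_const 2
  calc ∫⁻ x, ‖u (x + z) - u x‖ₑ ^ 2
      ≤ ∫⁻ x, ∫⁻ t, ‖fderiv ℝ u (x + t • z)‖ₑ ^ 2 * ‖z‖ₑ ^ 2 ∂ν := by
        refine lintegral_mono fun x => ?_
        rw [key]
        refine (enorm_integral_sq_le ν ?_).trans (lintegral_mono fun t => ?_)
        · exact Continuous.aestronglyMeasurable (by fun_prop)
        · rw [← mul_pow]
          gcongr
          exact ContinuousLinearMap.le_opENorm _ _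
    _ = ∫⁻ t, ∫⁻ x, ‖fderiv ℝ u (x + t • z)‖ₑ ^ 2 * ‖z‖ₑ ^ 2 ∂volume ∂ν :=
        lintegral_lintegral_swap (hm.mul_const _).aemeasurable
    _ = ∫⁻ _t, (∫⁻ x, ‖fderiv ℝ u x‖ₑ ^ 2) * ‖z‖ₑ ^ 2 ∂ν := by
        refine lintegral_congr fun t => ?_
        rw [lintegral_mul_const' _ _ (by simp)]
        congr 1
        exact lintegral_add_right_eq_self (fun x => ‖fderiv ℝ u x‖ₑ ^ 2) (t • z)
    _ = _ := by simp [mul_comm]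

/-- A `C¹` function is `L²`-close to its averages over small translations. -/
theorem lintegral_enorm_average_sub_sq_le {u : E3 → ℝ} (hu : ContDiff ℝ 1 u)
    (hc : HasCompactSupport u) (μ : Measure E3) [IsProbabilityMeasure μ] {r : ℝ≥0∞}
    (hμ : ∀ᵐ z ∂μ, ‖z‖ₑ ≤ r) :
    ∫⁻ x, ‖(∫ z, u (x + z) ∂μ) - u x‖ₑ ^ 2 ≤ r ^ 2 * ∫⁻ x, ‖fderiv ℝ u x‖ₑ ^ 2 := by
  have huc := hu.continuous
  obtain ⟨C, hC⟩ := hc.exists_bound_of_continuous huc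
  have hm : Measurable (fun p : E3 × E3 => ‖u (p.1 + p.2) - u p.1‖ₑ ^ 2) := by
    have : Continuous (fun p : E3 × E3 => u (p.1 + p.2) - u p.1) := by fun_prop
    exact this.enorm.measurable.pow_const 2
  calc ∫⁻ x, ‖(∫ z, u (x + z) ∂μ) - u x‖ₑ ^ 2
      ≤ ∫⁻ x, ∫⁻ z, ‖u (x + z) - u x‖ₑ ^ 2 ∂μ := by
        refine lintegral_mono fun x => ?_
        have hi : Integrable (fun z => u (x + z)) μ :=
          Integrable.of_bound (Continuous.aestronglyMeasurable (by fun_prop)) C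
            (ae_of_all _ fun z => hC _)
        have e : (∫ z, u (x + z) ∂μ) - u x = ∫ z, (u (x + z) - u x) ∂μ := by
          rw [integral_sub hi (integrable_const _)]; simp
        rw [e]
        exact enorm_integral_sq_le μ (Continuous.aestronglyMeasurable (by fun_prop))
    _ = ∫⁻ z, ∫⁻ x, ‖u (x + z) - u x‖ₑ ^ 2 ∂volume ∂μ :=
        lintegral_lintegral_swap hm.aemeasurable
    _ ≤ ∫⁻ _z, r ^ 2 * (∫⁻ x, ‖fderiv ℝ u x‖ₑ ^ 2) ∂μ := by
        refine lintegral_mono_ae ?_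
        filter_upwards [hμ] with z hz
        refine (lintegral_enorm_translate_sub_sq_le hu z).trans ?_
        gcongr
    _ = _ := by simp

/-! ### Weak compactness and Rellich's theorem for test functions. -/

/-- Bounded sequences of a separable Hilbert space have weakly convergent subsequences. -/
theorem exists_subseq_tendsto_inner {H : Type*} [NormedAddCommGroup H] [InnerProductSpace ℝ H]
    [CompleteSpace H] [TopologicalSpace.SeparableSpace H] {f : ℕ → H} {M : ℝ}
    (hf : ∀ n, ‖f n‖ ≤ M) :
    ∃ (g : H) (σ : ℕ → ℕ), StrictMono σ ∧
      ∀ h : H, Tendsto (fun n => inner ℝ (f (σ n)) h) atTop (𝓝 (inner ℝ g h)) := by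
  let T : H ≃ₗᵢ⋆[ℝ] StrongDual ℝ H := InnerProductSpace.toDual ℝ H
  obtain ⟨w, -, σ, hσ, hw⟩ := WeakDual.isSeqCompact_closedBall ℝ H (0 : StrongDual ℝ H) M
    (x := fun n => StrongDual.toWeakDual (T (f n))) (by intro n; simpa [T] using hf n)
  refine ⟨T.symm (WeakDual.toStrongDual w), σ, hσ, fun h => ?_⟩
  have h1 := ((WeakDual.eval_continuous (𝕜 := ℝ) h).tendsto w).comp hw
  have e : inner ℝ (T.symm (WeakDual.toStrongDual w)) h = w h := by
    simp [T]
  rw [e]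
  refine h1.congr fun n => ?_
  simp [T]

/-- A triangle inequality for squared `L²` distances, from `(s + t)² ≤ 2 s² + 2 t²`. Each use
multiplies the tolerance by 4, which `two_mul_div_four_add` balances. -/
theorem lintegral_enorm_sub_sq_le {f g h : E3 → ℝ} (hf : Measurable f) (hg : Measurable g) :
    ∫⁻ x, ‖f x - h x‖ₑ ^ 2 ≤ 2 * (∫⁻ x, ‖f x - g x‖ₑ ^ 2) + 2 * ∫⁻ x, ‖h x - g x‖ₑ ^ 2 := by
  rw [← lintegral_const_mul' _ _ (by simp), ← lintegral_const_mul' _ _ (by simp),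
    ← lintegral_add_left (by fun_prop)]
  refine lintegral_mono fun x => ?_
  have h1 : ‖f x - h x‖ₑ ≤ ‖f x - g x‖ₑ + ‖h x - g x‖ₑ := by
    have := enorm_sub_le (E := ℝ) (a := f x - g x) (b := h x - g x)
    simpa using this
  have h2 := ENNReal.rpow_add_le_mul_rpow_add_rpow ‖f x - g x‖ₑ ‖h x - g x‖ₑ (p := 2) (by norm_num)
  norm_num at h2
  calc ‖f x - h x‖ₑ ^ 2 ≤ (‖f x - g x‖ₑ + ‖h x - g x‖ₑ) ^ 2 := by gcongr
    _ ≤ _ := by rw [← mul_add]; exact h2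

theorem two_mul_div_four_add (x : ℝ≥0∞) : 2 * (x / 4) + 2 * (x / 4) = x := by
  rw [← add_mul, show (2 + 2 : ℝ≥0∞) = 4 by norm_num]
  exact ENNReal.mul_div_cancel (by simp) (by simp)

/-- The ball averages of an `L²`-bounded, weakly convergent sequence of test functions converge
strongly. -/
theorem exists_tendsto_average {Ω : Set E3} (hΩ : Bornology.IsBounded Ω) {φ : ℕ → E3 → ℝ}
    (hφ : ∀ n, IsTestFunction Ω (φ n)) {M : ℝ≥0∞} (hM : M ≠ ⊤)
    (hφM : ∀ n, ∫⁻ x, ‖φ n x‖ₑ ^ 2 ≤ M) {f : ℕ → Lp ℝ 2 (volume : Measure E3)}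
    (hf : ∀ n, f n =ᵐ[volume] φ n) {g : Lp ℝ 2 (volume : Measure E3)}
    (hw : ∀ h, Tendsto (fun n => inner ℝ (f n) h) atTop (𝓝 (inner ℝ g h))) {r : ℝ} (hr : 0 < r) :
    ∃ a : E3 → ℝ, Measurable a ∧ Tendsto (fun n => ∫⁻ x, ‖(∫ z, φ n (x + z)
      ∂(ProbabilityTheory.cond volume (Metric.ball (0 : E3) r))) - a x‖ₑ ^ 2) atTop (𝓝 0) := by
  set B := Metric.ball (0 : E3) r with hB
  have hBpos : volume B ≠ 0 := (Metric.measure_ball_pos volume (0 : E3) hr).ne'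
  have hBfin : volume B ≠ ⊤ := measure_ball_lt_top.ne
  set μ := ProbabilityTheory.cond volume B with hμ
  have : IsProbabilityMeasure μ := ProbabilityTheory.cond_isProbabilityMeasure_of_finite hBpos measure_ball_lt_top.ne
  have hμe : μ = (volume B)⁻¹ • volume.restrict B := rfl
  set A : ℕ → E3 → ℝ := fun n x => ∫ z, φ n (x + z) ∂μ with hA
  have hφc : ∀ n, Continuous (φ n) := fun n => (hφ n).smooth.continuous
  have hAm : ∀ n, Measurable (A n) := by
    intro n
    have : Continuous (fun p : E3 × E3 => φ n (p.1 + p.2)) :=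
      (hφc n).comp (by fun_prop)
    exact (this.stronglyMeasurable.integral_prod_right (ν := μ)).measurable
  -- the average is an inner product
  have hBx : ∀ x : E3, volume (Metric.ball x r) ≠ ⊤ := fun x => measure_ball_lt_top.ne
  have hAi : ∀ n x, A n x = (volume B).toReal⁻¹ *
      inner ℝ (f n) (indicatorConstLp 2 measurableSet_ball (hBx x) (1 : ℝ)) := by
    intro n x
    rw [real_inner_comm, L2.inner_indicatorConstLp_one]
    simp only [hA]
    rw [hμe, integral_smul_measure, ENNReal.toReal_inv, smul_eq_mul]
    congr 1
    have e1 : ∫ y in Metric.ball x r, f n y = ∫ y in Metric.ball x r, φ n y :=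
      integral_congr_ae (ae_restrict_of_ae (hf n))
    rw [e1, ← integral_indicator measurableSet_ball, ← integral_indicator measurableSet_ball,
      ← integral_add_left_eq_self ((Metric.ball x r).indicator _) x]
    congr 1
    ext z
    simp [Set.indicator]
  set a : E3 → ℝ := fun x => (volume B).toReal⁻¹ *
      inner ℝ g (indicatorConstLp 2 measurableSet_ball (hBx x) (1 : ℝ)) with ha
  -- Weak convergence tested on the indicator of the ball at `x` gives convergence at every point;
  -- the rest is dominated convergence.
  have hlim : ∀ x, Tendsto (fun n => A n x) atTop (𝓝 (a x)) := by
    intro x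
    simp only [hAi]
    exact (hw _).const_mul _
  have ham : Measurable a := measurable_of_tendsto_metrizable hAm (tendsto_pi_nhds.2 hlim)
  -- uniform bound
  set C : ℝ≥0∞ := (volume B)⁻¹ * M with hC
  have hCfin : C ≠ ⊤ := ENNReal.mul_ne_top (ENNReal.inv_ne_top.2 hBpos) hM
  have hAC : ∀ n x, ‖A n x‖ₑ ^ 2 ≤ C := by
    intro n x
    calc ‖A n x‖ₑ ^ 2 ≤ ∫⁻ z, ‖φ n (x + z)‖ₑ ^ 2 ∂μ :=
          enorm_integral_sq_le μ
            (((hφc n).comp (by fun_prop : Continuous fun z => x + z)).aestronglyMeasurable)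
      _ ≤ (volume B)⁻¹ * ∫⁻ z, ‖φ n (x + z)‖ₑ ^ 2 := by
          rw [hμe, lintegral_smul_measure, smul_eq_mul]
          exact mul_le_mul_right (setLIntegral_le_lintegral _ _) _
      _ ≤ C := by
          rw [lintegral_add_left_eq_self (fun z => ‖φ n z‖ₑ ^ 2) x]
          exact mul_le_mul_right (hφM n) _
  have haC : ∀ x, ‖a x‖ₑ ^ 2 ≤ C := fun x =>
    le_of_tendsto (((ENNReal.continuous_pow 2).tendsto _).comp
      ((continuous_enorm.tendsto _).comp (hlim x))) (Eventually.of_forall fun n => hAC n x)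
  -- All averages vanish off the `r`-neighbourhood of `Ω`, which has finite measure because `Ω` is
  -- bounded; a constant on it is an integrable majorant.
  set K := Metric.thickening r Ω with hK
  have hA0 : ∀ n x, x ∉ K → A n x = 0 := by
    intro n x hx
    have hz : ∀ᵐ z ∂μ, φ n (x + z) = 0 := by
      have h1 : ∀ᵐ z ∂(volume.restrict B), φ n (x + z) = 0 := by
        filter_upwards [ae_restrict_mem measurableSet_ball] with z hz
        by_contra h
        apply hx
        rw [hK, Metric.mem_thickening_iff]
        refine ⟨x + z, (hφ n).subset (subset_tsupport _ h), ?_⟩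
        simpa [hB] using hz
      rw [hμe]
      exact Measure.ae_smul_measure h1 _
    simp only [hA]
    rw [integral_congr_ae hz]; simp
  have ha0 : ∀ x, x ∉ K → a x = 0 := fun x hx =>
    tendsto_nhds_unique (hlim x) (by simp [hA0 _ x hx])
  have hKfin : volume K ≠ ⊤ := hΩ.thickening.measure_lt_top.ne
  refine ⟨a, ham, ?_⟩
  have hdom := tendsto_lintegral_of_dominated_convergence (μ := volume)
    (F := fun n x => ‖A n x - a x‖ₑ ^ 2) (f := fun _ => 0)
    (K.indicator fun _ => 4 * C) (fun n => by fun_prop) (fun n => ae_of_all _ fun x => ?_) ?_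
    (ae_of_all _ fun x => ?_)
  · simpa using hdom
  · by_cases hx : x ∈ K
    · simp only [Set.indicator_of_mem hx]
      have h2 := ENNReal.rpow_add_le_mul_rpow_add_rpow ‖A n x‖ₑ ‖a x‖ₑ (p := 2) (by norm_num)
      norm_num at h2
      calc ‖A n x - a x‖ₑ ^ 2 ≤ (‖A n x‖ₑ + ‖a x‖ₑ) ^ 2 := by gcongr; exact enorm_sub_le
        _ ≤ 2 * (‖A n x‖ₑ ^ 2 + ‖a x‖ₑ ^ 2) := h2
        _ ≤ 2 * (C + C) := by gcongr; exacts [hAC n x, haC x]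
        _ = 4 * C := by ring
    · simp [hx, hA0 n x hx, ha0 x hx]
  · rw [lintegral_indicator Metric.isOpen_thickening.measurableSet]
    simp only [lintegral_const, Measure.restrict_apply_univ]
    exact ENNReal.mul_ne_top (ENNReal.mul_ne_top (by simp) hCfin) hKfin
  · have h1 : Tendsto (fun n => A n x - a x) atTop (𝓝 0) := by
      simpa using (hlim x).sub_const (a x)
    have h2 := ((ENNReal.continuous_pow 2).tendsto _).comp ((continuous_enorm.tendsto _).comp h1)
    simpa [Function.comp_def] using h2

/-- **Rellich's theorem** for test functions. -/
theorem exists_subseq_tendsto_lintegral_sub {Ω : Set E3} (hΩ : Bornology.IsBounded Ω)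
    {φ : ℕ → E3 → ℝ} (hφ : ∀ n, IsTestFunction Ω (φ n)) {M : ℝ≥0∞} (hM : M ≠ ⊤)
    (hφM : ∀ n, ∫⁻ x, ‖φ n x‖ₑ ^ 2 ≤ M) (hdM : ∀ n, ∫⁻ x, ‖fderiv ℝ (φ n) x‖ₑ ^ 2 ≤ M) :
    ∃ σ : ℕ → ℕ, StrictMono σ ∧ Tendsto (fun p : ℕ × ℕ =>
      ∫⁻ x, ‖φ (σ p.1) x - φ (σ p.2) x‖ₑ ^ 2) atTop (𝓝 0) := by
  have hmem : ∀ n, MemLp (φ n) 2 (volume : Measure E3) := fun n =>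
    (hφ n).smooth.continuous.memLp_of_hasCompactSupport (hφ n).compact
  have hbd : ∀ n, ‖(hmem n).toLp‖ ≤ (M ^ (1 / 2 : ℝ)).toReal := by
    intro n
    rw [Lp.norm_toLp]
    refine ENNReal.toReal_mono (ENNReal.rpow_ne_top_of_nonneg (by norm_num) hM) ?_
    rw [eLpNorm_eq_lintegral_rpow_enorm_toReal (by simp) (by simp)]
    simp only [ENNReal.toReal_ofNat, ENNReal.rpow_two]
    gcongr
    exact hφM n
  -- Supplied for the instance that makes `L²` separable.
  have : Fact ((2 : ℝ≥0∞) ≠ ⊤) := ⟨by simp⟩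
  obtain ⟨g, σ, hσ, hw⟩ := exists_subseq_tendsto_inner hbd
  refine ⟨σ, hσ, ?_⟩
  have hmeas : ∀ n, Measurable (φ n) := fun n => (hφ n).smooth.continuous.measurable
  rw [ENNReal.tendsto_nhds_zero]
  intro ε hε
  -- Two nested uses of `lintegral_enorm_sub_sq_le` follow: through the average of `φ` to its limit
  -- `a`, then through `a` to another member of the sequence.
  have hε16 : 0 < ε / 4 / 4 :=
    ENNReal.div_pos (ENNReal.div_pos hε.ne' (by simp)).ne' (by simp)
  obtain ⟨r, hr, hrε⟩ : ∃ r : ℝ, 0 < r ∧ ENNReal.ofReal r ^ 2 * M ≤ ε / 4 / 4 := by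
    have hc : Tendsto (fun r : ℝ => ENNReal.ofReal r ^ 2 * M) (𝓝[>] 0) (𝓝 0) := by
      have h1 : Tendsto (fun r : ℝ => ENNReal.ofReal r ^ 2 * M) (𝓝 0)
          (𝓝 (ENNReal.ofReal 0 ^ 2 * M)) :=
        ENNReal.Tendsto.mul_const (((ENNReal.continuous_pow 2).tendsto _).comp
          (ENNReal.continuous_ofReal.tendsto 0)) (Or.inr hM)
      simpa using h1.mono_left nhdsWithin_le_nhds
    have h2 := (ENNReal.tendsto_nhds_zero.1 hc) (ε / 4 / 4)
      hε16
    obtain ⟨r, h3, h4⟩ := (h2.and self_mem_nhdsWithin).exists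
    exact ⟨r, h4, h3⟩
  obtain ⟨a, ham, hlim⟩ := exists_tendsto_average hΩ (φ := fun n => φ (σ n)) (fun n => hφ _) hM
    (fun n => hφM _) (fun n => (hmem (σ n)).coeFn_toLp) hw hr
  have hBpos : volume (Metric.ball (0 : E3) r) ≠ 0 :=
    (Metric.measure_ball_pos volume (0 : E3) hr).ne'
  set μ := ProbabilityTheory.cond volume (Metric.ball (0 : E3) r) with hμ
  have : IsProbabilityMeasure μ := ProbabilityTheory.cond_isProbabilityMeasure_of_finite hBpos measure_ball_lt_top.ne
  have hμr : ∀ᵐ z ∂μ, ‖z‖ₑ ≤ ENNReal.ofReal r := by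
    filter_upwards [ProbabilityTheory.ae_cond_mem measurableSet_ball] with z hz
    rw [← ofReal_norm]
    exact ENNReal.ofReal_le_ofReal (by simpa using (Metric.mem_ball.1 hz).le)
  have hA : ∀ n, ∫⁻ x, ‖φ n x - ∫ z, φ n (x + z) ∂μ‖ₑ ^ 2 ≤ ε / 4 / 4 := by
    intro n
    simp_rw [fun x => enorm_sub_rev (φ n x) (∫ z, φ n (x + z) ∂μ)]
    refine (lintegral_enorm_average_sub_sq_le ((hφ n).smooth.of_le (by simp)) (hφ n).compact μ
      hμr).trans (le_trans ?_ hrε)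
    gcongr
    exact hdM n
  have hAm : ∀ n, Measurable (fun x => ∫ z, φ n (x + z) ∂μ) := by
    intro n
    have : Continuous (fun p : E3 × E3 => φ n (p.1 + p.2)) :=
      (hφ n).smooth.continuous.comp (by fun_prop)
    exact (this.stronglyMeasurable.integral_prod_right (ν := μ)).measurable
  have hev : ∀ᶠ n in atTop, ∫⁻ x, ‖φ (σ n) x - a x‖ₑ ^ 2 ≤ ε / 4 := by
    filter_upwards [(ENNReal.tendsto_nhds_zero.1 hlim) (ε / 4 / 4) hε16]
      with n hn
    refine (lintegral_enorm_sub_sq_le (hmeas _) (hAm (σ n))).trans ?_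
    simp_rw [fun x => enorm_sub_rev (a x) (∫ z, φ (σ n) (x + z) ∂μ)]
    refine (add_le_add (mul_le_mul_right (hA (σ n)) 2) (mul_le_mul_right hn 2)).trans ?_
    rw [two_mul_div_four_add]
  rw [← prod_atTop_atTop_eq]
  filter_upwards [hev.prod_mk hev] with p hp
  refine (lintegral_enorm_sub_sq_le (hmeas _) ham).trans ?_
  refine (add_le_add (mul_le_mul_right hp.1 2) (mul_le_mul_right hp.2 2)).trans ?_
  rw [two_mul_div_four_add]

/-! ### The direct method in abstract form. -/

/-- If `G` is a seminorm that is compact with respect to the Hilbert seminorm `‖T ·‖`, then the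
quotient `G / ‖T ·‖` attains its maximum. -/
theorem exists_maximizer_of_compact {H F : Type*} [NormedAddCommGroup H] [NormedSpace ℝ H]
    [CompleteSpace H] [NormedAddCommGroup F] [InnerProductSpace ℝ F] (T : H →L[ℝ] F)
    (G : Seminorm ℝ H) {C c : ℝ} (hT : ∀ u, ‖u‖ ≤ C * ‖T u‖) (hG : ∀ u, G u ≤ c * ‖T u‖)
    (hne : ∃ v, G v ≠ 0)
    (hcomp : ∀ u : ℕ → H, (∀ n, ‖T (u n)‖ ≤ 1) → ∃ σ : ℕ → ℕ, StrictMono σ ∧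
      Tendsto (fun p : ℕ × ℕ => G (u (σ p.1) - u (σ p.2))) atTop (𝓝 0)) :
    ∃ u, ‖T u‖ = 1 ∧ ∀ v, G v ≤ G u * ‖T v‖ := by
  set S : Set ℝ := G '' {u | ‖T u‖ ≤ 1} with hS
  have hbdd : BddAbove S := by
    refine ⟨|c|, ?_⟩
    rintro _ ⟨u, hu, rfl⟩
    calc G u ≤ c * ‖T u‖ := hG u
      _ ≤ |c| * 1 := mul_le_mul (le_abs_self c) hu (norm_nonneg _) (abs_nonneg _)
      _ = |c| := mul_one _
  have hSne : S.Nonempty := ⟨G 0, 0, by simp, rfl⟩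
  set M := sSup S with hM
  have hGM : ∀ v, G v ≤ M * ‖T v‖ := by
    intro v
    rcases (norm_nonneg (T v)).eq_or_lt with h0 | h0
    · have := hG v
      rw [← h0] at this ⊢
      linarith
    · have h1 : G (‖T v‖⁻¹ • v) ≤ M := by
        refine le_csSup hbdd ⟨_, ?_, rfl⟩
        simp [norm_smul, h0.ne']
      rw [map_smul_eq_mul, norm_inv, norm_norm, inv_mul_le_iff₀ h0] at h1
      linarith
  have hMpos : 0 < M := by
    obtain ⟨v, hv⟩ := hne
    have h1 : 0 < G v := lt_of_le_of_ne (apply_nonneg G v) (Ne.symm hv)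
    by_contra h
    have := hGM v
    have := mul_nonpos_of_nonpos_of_nonneg (not_lt.1 h) (norm_nonneg (T v))
    linarith
  obtain ⟨s, -, hs, hsS⟩ := exists_seq_tendsto_sSup hSne hbdd
  choose w hw hws using hsS
  obtain ⟨σ, hσ, hGσ⟩ := hcomp w hw
  set u : ℕ → H := fun n => w (σ n) with hu
  have hu1 : ∀ n, ‖T (u n)‖ ≤ 1 := fun n => hw _
  have hGu : Tendsto (fun n => G (u n)) atTop (𝓝 M) := by
    have := hs.comp hσ.tendsto_atTop
    refine this.congr fun n => ?_
    simp [hu, hws]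
  have hfst : Tendsto (fun p : ℕ × ℕ => G (u p.1)) atTop (𝓝 M) :=
    hGu.comp (by rw [← prod_atTop_atTop_eq]; exact tendsto_fst)
  -- the parallelogram identity forces the gradients to converge
  have hpar : ∀ p : ℕ × ℕ, ‖T (u p.1 - u p.2)‖ ^ 2 ≤
      4 - max 0 ((2 * G (u p.1) - G (u p.1 - u p.2)) / M) ^ 2 := by
    intro p
    have h1 := parallelogram_law_with_norm ℝ (T (u p.1)) (T (u p.2))
    rw [← map_add, ← map_sub] at h1
    -- A nearly maximal `G` on the midpoint forces `‖T ·‖` of the sum to be nearly 2. The truncation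
    -- at 0 keeps squaring monotone.
    have h2 : max 0 ((2 * G (u p.1) - G (u p.1 - u p.2)) / M) ≤ ‖T (u p.1 + u p.2)‖ := by
      refine max_le (norm_nonneg _) ?_
      rw [div_le_iff₀ hMpos]
      have h3 : G (u p.1 + u p.1) ≤ G (u p.1 + u p.2) + G (u p.1 - u p.2) := by
        refine le_trans (le_of_eq ?_) (map_add_le_add G _ _)
        congr 1; abel
      have h4 : G (u p.1 + u p.1) = 2 * G (u p.1) := by
        rw [← two_smul ℝ (u p.1), map_smul_eq_mul]; norm_num
      have := hGM (u p.1 + u p.2)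
      linarith
    have h5 := pow_le_pow_left₀ (le_max_left 0 _) h2 2
    have h6 := pow_le_pow_left₀ (norm_nonneg _) (hu1 p.1) 2
    have h7 := pow_le_pow_left₀ (norm_nonneg _) (hu1 p.2) 2
    nlinarith
  have hlim : Tendsto (fun p : ℕ × ℕ => 4 -
      max 0 ((2 * G (u p.1) - G (u p.1 - u p.2)) / M) ^ 2) atTop (𝓝 0) := by
    have h1 : Tendsto (fun p : ℕ × ℕ => 4 -
      max 0 ((2 * G (u p.1) - G (u p.1 - u p.2)) / M) ^ 2) atTop
        (𝓝 (4 - max 0 ((2 * M - 0) / M) ^ 2)) :=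
      tendsto_const_nhds.sub ((tendsto_const_nhds.max
        (((hfst.const_mul 2).sub hGσ).div_const M)).pow 2)
    have h2 : (4 - max 0 ((2 * M - 0) / M) ^ 2 : ℝ) = 0 := by
      rw [sub_zero, mul_div_cancel_right₀ _ hMpos.ne']; norm_num
    rwa [h2] at h1
  have hT0 : Tendsto (fun p : ℕ × ℕ => ‖T (u p.1 - u p.2)‖) atTop (𝓝 0) := by
    have h1 := squeeze_zero (fun p => sq_nonneg _) hpar hlim
    have h2 := (Real.continuous_sqrt.tendsto 0).comp h1
    simpa [Function.comp_def, Real.sqrt_sq] using h2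
  have hcau : CauchySeq u := by
    rw [cauchySeq_iff_tendsto_dist_atTop_0]
    refine squeeze_zero (fun p => dist_nonneg) (fun p => ?_)
      (by simpa using hT0.const_mul C : Tendsto (fun p : ℕ × ℕ => C * ‖T (u p.1 - u p.2)‖) _ _)
    rw [dist_eq_norm]
    exact hT _
  obtain ⟨v, hv⟩ := cauchySeq_tendsto_of_complete hcau
  have hTv : ‖T v‖ ≤ 1 :=
    le_of_tendsto ((T.continuous.norm.tendsto v).comp hv) (Eventually.of_forall hu1)
  have hGv : M ≤ G v := by
    have h1 : Tendsto (fun n => G v + c * ‖T (u n - v)‖) atTop (𝓝 (G v + c * ‖T (v - v)‖)) := by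
      have h2 : Continuous fun x => G v + c * ‖T (x - v)‖ := by fun_prop
      exact (h2.tendsto v).comp hv
    simp only [sub_self, map_zero, norm_zero, mul_zero, add_zero] at h1
    refine le_of_tendsto_of_tendsto' hGu h1 fun n => ?_
    have h3 : G (u n) ≤ G v + G (u n - v) := by
      have := map_add_le_add G v (u n - v)
      simpa using this
    linarith [hG (u n - v)]
  -- From `M ≤ G v ≤ M * ‖T v‖` and `M > 0`.
  have hTv1 : ‖T v‖ = 1 := by
    have h1 := hGM v
    refine le_antisymm hTv ?_
    by_contra h
    nlinarith
  refine ⟨v, hTv1, fun x => (hGM x).trans ?_⟩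
  gcongr

/-! ### Sobolev inequality and the two norms on `H_0^1(Ω)`. -/

/-- The bound 6 is the critical Sobolev exponent: `1/2 - 1/3 = 1/6` in dimension three. Exponents
below it use that `Ω` is bounded. -/
theorem IsTestFunction.eLpNorm_le {Ω : Set E3} (hΩ : Bornology.IsBounded Ω) {q : NNReal}
    (hq0 : q ≠ 0) (hq : q ≤ 6) {φ : E3 → ℝ} (hφ : IsTestFunction Ω φ) :
    eLpNorm φ q volume ≤
      eLpNormLESNormFDerivOfLeConst ℝ (volume : Measure E3) Ω 2 q *
        eLpNorm (fderiv ℝ φ) 2 volume := by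
  have h := eLpNorm_le_eLpNorm_fderiv_of_le (volume : Measure E3) (p := 2) (q := q)
    (hφ.smooth.of_le (by simp)) ((subset_tsupport φ).trans hφ.subset) (by norm_num)
    (by simp; norm_num) ?_ hΩ
  · exact h
  · have h1 : (q : ℝ) ≤ 6 := by exact_mod_cast hq
    have h2 : (0 : ℝ) < q := by positivity
    have h3 : (6 : ℝ)⁻¹ ≤ (q : ℝ)⁻¹ := inv_anti₀ h2 h1
    simp only [finrank_euclideanSpace, Fintype.card_fin]
    push_cast
    linarith

theorem enorm_gradient (φ : E3 → ℝ) (x : E3) : ‖gradient φ x‖ₑ = ‖fderiv ℝ φ x‖ₑ := by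
  rw [← ofReal_norm, ← ofReal_norm, gradient, LinearIsometryEquiv.norm_map]

theorem IsTestFunction.eLpNorm_fst {Ω : Set E3} {φ : E3 → ℝ} (hφ : IsTestFunction Ω φ)
    {p : L2Pair Ω} (hp : p.fst =ᵐ[volume.restrict Ω] φ) (q : ℝ≥0∞) :
    eLpNorm p.fst q (volume.restrict Ω) = eLpNorm φ q volume := by
  rw [eLpNorm_congr_ae hp,
    eLpNorm_restrict_eq_of_support_subset ((subset_tsupport φ).trans hφ.subset)]

theorem IsTestFunction.eLpNorm_snd {Ω : Set E3} {φ : E3 → ℝ} (hφ : IsTestFunction Ω φ)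
    {p : L2Pair Ω} (hp : p.snd =ᵐ[volume.restrict Ω] gradient φ) (q : ℝ≥0∞) :
    eLpNorm p.snd q (volume.restrict Ω) = eLpNorm (fderiv ℝ φ) q volume := by
  rw [eLpNorm_congr_ae hp, eLpNorm_restrict_eq_of_support_subset]
  · exact eLpNorm_congr_enorm_ae (ae_of_all _ (enorm_gradient φ))
  · intro x hx
    refine hφ.subset (support_fderiv_subset ℝ ?_)
    intro h
    apply hx
    simp [gradient, h]

/-- The Sobolev inequality in `H_0^1(Ω)`. -/
theorem eLpNorm_val_le {Ω : Set E3} (hΩ : Bornology.IsBounded Ω) {q : NNReal}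
    (hq0 : q ≠ 0) (hq : q ≤ 6) (u : H01 Ω) :
    eLpNorm (val u) q (volume.restrict Ω) ≤
      eLpNormLESNormFDerivOfLeConst ℝ (volume : Measure E3) Ω 2 q * gradNorm u := by
  set K := eLpNormLESNormFDerivOfLeConst ℝ (volume : Measure E3) Ω 2 q with hK
  obtain ⟨p, hp, hpu⟩ := mem_closure_iff_seq_limit.1 u.2
  have c1 : Continuous (fun p : L2Pair Ω => p.fst) := by fun_prop
  have c2 : Continuous (fun p : L2Pair Ω => p.snd) := by fun_prop
  have h1 := (c1.tendsto _).comp hpu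
  have h2 := (c2.tendsto _).comp hpu
  -- The approximation is in `L²` only. Almost everywhere convergence along a subsequence and
  -- Fatou's lemma give lower semicontinuity of the `L^q` norm, while the gradient norms converge.
  obtain ⟨σ, hσ, hae⟩ := (tendstoInMeasure_of_tendsto_Lp h1).exists_seq_tendsto_ae
  have hle : ∀ n, eLpNorm (p n).fst q (volume.restrict Ω) ≤
      K * eLpNorm (p n).snd 2 (volume.restrict Ω) := by
    intro n
    obtain ⟨φ, hφ, e1, e2⟩ := hp n
    rw [hφ.eLpNorm_fst e1, hφ.eLpNorm_snd e2]
    exact hφ.eLpNorm_le hΩ hq0 hq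
  have hlim : Tendsto (fun n => K * eLpNorm (p (σ n)).snd 2 (volume.restrict Ω)) atTop
      (𝓝 (K * gradNorm u)) := by
    refine ENNReal.Tendsto.const_mul ?_ (Or.inr (by simp))
    have h3 := (continuous_enorm.tendsto _).comp (h2.comp hσ.tendsto_atTop)
    simp only [Function.comp_def, Lp.enorm_def] at h3
    exact h3
  calc eLpNorm (val u) q (volume.restrict Ω)
      ≤ liminf (fun n => eLpNorm (p (σ n)).fst q (volume.restrict Ω)) atTop :=
        Lp.eLpNorm_lim_le_liminf_eLpNorm (fun n => (Lp.aestronglyMeasurable _)) _ hae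
    _ ≤ liminf (fun n => K * eLpNorm (p (σ n)).snd 2 (volume.restrict Ω)) atTop :=
        liminf_le_liminf (Eventually.of_forall fun n => hle _)
    _ = _ := hlim.liminf_eq

theorem aestronglyMeasurable_val {Ω : Set E3} (u : H01 Ω) :
    AEStronglyMeasurable (val u) (volume.restrict Ω) := Lp.aestronglyMeasurable _

theorem gradNorm_ne_top {Ω : Set E3} (u : H01 Ω) : gradNorm u ≠ ⊤ := Lp.eLpNorm_ne_top _

/-- Poincaré's inequality, that is, the case `q = 2` of `eLpNorm_val_le`. -/
theorem gradNorm_ne_zero {Ω : Set E3} (hΩo : IsOpen Ω) (hΩ : Bornology.IsBounded Ω) {u : H01 Ω}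
    (hu : u ≠ 0) : gradNorm u ≠ 0 := by
  intro h
  apply hu
  have h1 := eLpNorm_val_le hΩ (q := 2) (by simp) (by norm_num) u
  rw [h, mul_zero, nonpos_iff_eq_zero, eLpNorm_eq_zero_iff (aestronglyMeasurable_val u) (by simp)]
    at h1
  exact eq_zero_of_val hΩo u h1

theorem gammaNorm_ne_zero {Ω : Set E3} (hΩo : IsOpen Ω) {γ : ℝ} (hγ : 0 < γ) {u : H01 Ω}
    (hu : u ≠ 0) : gammaNorm γ u ≠ 0 := by
  intro h
  rw [gammaNorm, eLpNorm_eq_zero_iff (aestronglyMeasurable_val u) (by simpa using hγ)] at h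
  exact hu (eq_zero_of_val hΩo u h)

theorem gammaNorm_le {Ω : Set E3} (hΩ : Bornology.IsBounded Ω) {γ : ℝ} (hγ : 0 < γ) (hγ6 : γ ≤ 6)
    (u : H01 Ω) : gammaNorm γ u ≤
      eLpNormLESNormFDerivOfLeConst ℝ (volume : Measure E3) Ω 2 γ.toNNReal * gradNorm u :=
  eLpNorm_val_le hΩ (by simpa using hγ) (by simpa [Real.toNNReal_le_iff_le_coe] using hγ6) u

theorem gammaNorm_ne_top {Ω : Set E3} (hΩ : Bornology.IsBounded Ω) {γ : ℝ} (hγ : 0 < γ)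
    (hγ6 : γ ≤ 6) (u : H01 Ω) : gammaNorm γ u ≠ ⊤ :=
  ne_top_of_le_ne_top (ENNReal.mul_ne_top (by simp) (gradNorm_ne_top u)) (gammaNorm_le hΩ hγ hγ6 u)

theorem val_add {Ω : Set E3} (u v : H01 Ω) :
    val (u + v) =ᵐ[volume.restrict Ω] val u + val v := Lp.coeFn_add _ _

theorem val_smul {Ω : Set E3} (c : ℝ) (u : H01 Ω) :
    val (c • u) =ᵐ[volume.restrict Ω] c • val u := Lp.coeFn_smul _ _

theorem grad_smul {Ω : Set E3} (c : ℝ) (u : H01 Ω) :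
    grad (c • u) =ᵐ[volume.restrict Ω] c • grad u := Lp.coeFn_smul _ _

/-- The `L^γ` norm as a real-valued seminorm on `H_0^1(Ω)`. -/
def gammaSeminorm {Ω : Set E3} (hΩ : Bornology.IsBounded Ω) {γ : ℝ} (hγ : 1 ≤ γ) (hγ6 : γ ≤ 6) :
    Seminorm ℝ (H01 Ω) :=
  Seminorm.of (fun u => (gammaNorm γ u).toReal)
    (fun u v => by
      rw [← ENNReal.toReal_add (gammaNorm_ne_top hΩ (by linarith) hγ6 u)
        (gammaNorm_ne_top hΩ (by linarith) hγ6 v)]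
      refine ENNReal.toReal_mono (ENNReal.add_ne_top.2 ⟨gammaNorm_ne_top hΩ (by linarith) hγ6 u,
        gammaNorm_ne_top hΩ (by linarith) hγ6 v⟩) ?_
      unfold gammaNorm
      rw [eLpNorm_congr_ae (val_add u v)]
      exact eLpNorm_add_le (aestronglyMeasurable_val u) (aestronglyMeasurable_val v) (by simpa))
    (fun c u => by
      unfold gammaNorm
      rw [eLpNorm_congr_ae (val_smul c u), eLpNorm_const_smul]
      simp)

/-- The gradient as a bounded operator on `H_0^1(Ω)`. -/
def gradCLM (Ω : Set E3) : H01 Ω →L[ℝ] Lp E3 2 (volume.restrict Ω) :=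
  ⟨{ toFun := fun u => (u : L2Pair Ω).snd
     map_add' := fun _ _ => rfl
     map_smul' := fun _ _ => rfl }, by
    have c2 : Continuous (fun p : L2Pair Ω => p.snd) := by fun_prop
    exact c2.comp continuous_subtype_val⟩

theorem norm_gradCLM {Ω : Set E3} (u : H01 Ω) : ‖gradCLM Ω u‖ = (gradNorm u).toReal :=
  Lp.norm_def _

/-! ### Compactness of the embeddings and existence of a maximizer. -/

/-- Interpolation of the `L^γ` norm between `L²` and `L^{2(γ-1)}`. -/
theorem eLpNorm_rpow_le_mul {α : Type*} [MeasurableSpace α] {μ : Measure α} {f : α → ℝ}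
    (hf : AEStronglyMeasurable f μ) {γ : ℝ} (hγ : 1 < γ) :
    eLpNorm f (ENNReal.ofReal γ) μ ^ γ ≤
      eLpNorm f 2 μ * eLpNorm f (ENNReal.ofReal (2 * (γ - 1))) μ ^ (γ - 1) := by
  have h0 : (0 : ℝ) < γ - 1 := by linarith
  rw [eLpNorm_eq_lintegral_rpow_enorm_toReal (by simp; linarith) (by simp),
    eLpNorm_eq_lintegral_rpow_enorm_toReal (by simp) (by simp),
    eLpNorm_eq_lintegral_rpow_enorm_toReal (by simp; linarith) ENNReal.ofReal_ne_top,
    ENNReal.toReal_ofReal (by linarith), ENNReal.toReal_ofReal (by linarith),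
    ← ENNReal.rpow_mul, ← ENNReal.rpow_mul, one_div_mul_cancel (by linarith), ENNReal.rpow_one,
    show 1 / (2 * (γ - 1)) * (γ - 1) = 1 / 2 by field_simp]
  -- Cauchy–Schwarz for the splitting `|f|^γ = |f| · |f|^(γ-1)`.
  have h := ENNReal.lintegral_mul_le_Lp_mul_Lq μ Real.HolderConjugate.two_two hf.enorm
    (hf.enorm.pow_const (γ - 1))
  simp only [Pi.mul_apply, ← ENNReal.rpow_mul] at h
  rw [mul_comm 2 (γ - 1)]
  refine le_trans (le_of_eq (lintegral_congr fun x => ?_)) h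
  have h1 : ‖f x‖ₑ ^ γ = ‖f x‖ₑ ^ (1 + (γ - 1)) := by congr 1; ring
  rw [h1, ENNReal.rpow_add_of_nonneg _ _ zero_le_one h0.le, ENNReal.rpow_one]

/-- **Rellich's theorem** in `H_0^1(Ω)`. -/
theorem exists_subseq_tendsto_val {Ω : Set E3} (hΩ : Bornology.IsBounded Ω) {u : ℕ → H01 Ω}
    (hu : ∀ n, ‖gradCLM Ω (u n)‖ ≤ 1) :
    ∃ σ : ℕ → ℕ, StrictMono σ ∧ Tendsto (fun p : ℕ × ℕ =>
      eLpNorm (val (u (σ p.1) - u (σ p.2))) 2 (volume.restrict Ω)) atTop (𝓝 0) := by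
  -- Distances at most 1 keep the gradients of the test functions bounded by 2; distances tending to
  -- 0 transfer the Cauchy property back to `u`.
  have hap : ∀ n, ∃ p ∈ testPairs Ω, dist (u n : L2Pair Ω) p < 1 / ((n : ℝ) + 1) := fun n =>
    Metric.mem_closure_iff.1 (u n).2 _ (by positivity)
  choose p hp hpu using hap
  choose φ hφ e1 e2 using hp
  set K : ℝ≥0∞ := ↑(eLpNormLESNormFDerivOfLeConst ℝ (volume : Measure E3) Ω 2 2) with hK
  have hfst : ∀ q : L2Pair Ω, ‖q.fst‖ ≤ ‖q‖ := fun q => WithLp.norm_fst_le _ q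
  have hsnd : ∀ q : L2Pair Ω, ‖q.snd‖ ≤ ‖q‖ := fun q => WithLp.norm_snd_le _ q
  have hd : ∀ n, eLpNorm (fderiv ℝ (φ n)) 2 volume ≤ 2 := by
    intro n
    rw [← (hφ n).eLpNorm_snd (e2 n), ← Lp.enorm_def, ← ofReal_norm]
    refine (ENNReal.ofReal_le_ofReal ?_).trans_eq (by simp : ENNReal.ofReal 2 = 2)
    have h1 := hsnd (p n - u n)
    have h2 : ‖(p n - u n : L2Pair Ω)‖ ≤ 1 := by
      rw [← dist_eq_norm, dist_comm]
      refine (hpu n).le.trans ?_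
      rw [div_le_one (by positivity)]
      linarith [(Nat.cast_nonneg n : (0 : ℝ) ≤ n)]
    have h3 : (p n).snd = (p n - u n : L2Pair Ω).snd + (u n : L2Pair Ω).snd := by
      simp
    rw [h3]
    have h4 : ‖(u n : L2Pair Ω).snd‖ ≤ 1 := hu n
    linarith [norm_add_le (p n - u n : L2Pair Ω).snd (u n : L2Pair Ω).snd]
  have hsq : ∀ {F : Type} [NormedAddCommGroup F] (f : E3 → F),
      ∫⁻ x, ‖f x‖ₑ ^ 2 = eLpNorm f 2 volume ^ 2 := by
    intro F _ f
    rw [eLpNorm_eq_lintegral_rpow_enorm_toReal (by simp) (by simp), ← ENNReal.rpow_natCast,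
      ← ENNReal.rpow_mul]
    simp
  obtain ⟨σ, hσ, hlim⟩ := exists_subseq_tendsto_lintegral_sub hΩ hφ (M := (K * 2) ^ 2 + 2 ^ 2)
    (ENNReal.add_ne_top.2 ⟨ENNReal.pow_ne_top (ENNReal.mul_ne_top (by simp [hK]) (by simp)),
      by simp⟩)
    (fun n => by
      rw [hsq]
      refine le_trans ?_ le_self_add
      gcongr
      refine ((hφ n).eLpNorm_le hΩ (q := 2) (by simp) (by norm_num)).trans ?_
      gcongr
      exact hd n)
    (fun n => by
      rw [hsq]
      refine le_trans ?_ le_add_self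
      gcongr
      exact hd n)
  refine ⟨σ, hσ, ?_⟩
  have hφlim : Tendsto (fun m : ℕ × ℕ => eLpNorm (φ (σ m.1) - φ (σ m.2)) 2 volume) atTop
      (𝓝 0) := by
    have h1 := (ENNReal.continuous_rpow_const (y := (1 / 2 : ℝ))).tendsto 0 |>.comp hlim
    have h2 : (0 : ℝ≥0∞) ^ (1 / 2 : ℝ) = 0 := by simp
    rw [h2] at h1
    refine h1.congr fun m => ?_
    simp only [Function.comp_apply]
    rw [eLpNorm_eq_lintegral_rpow_enorm_toReal (by simp) (by simp)]
    simp
  have herr : Tendsto (fun n : ℕ => ‖((u (σ n) : L2Pair Ω) - p (σ n)).fst‖ₑ) atTop (𝓝 0) := by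
    have h1 : Tendsto (fun n : ℕ => ‖((u (σ n) : L2Pair Ω) - p (σ n)).fst‖) atTop (𝓝 0) := by
      refine squeeze_zero (fun n => norm_nonneg _) (fun n => (hfst _).trans ?_)
        (tendsto_one_div_add_atTop_nhds_zero_nat.comp hσ.tendsto_atTop)
      rw [← dist_eq_norm]
      exact (hpu _).le
    simpa [Function.comp_def] using (ENNReal.continuous_ofReal.tendsto 0).comp h1
  have herr1 : Tendsto (fun m : ℕ × ℕ => ‖((u (σ m.1) : L2Pair Ω) - p (σ m.1)).fst‖ₑ) atTop
      (𝓝 0) := herr.comp (by rw [← prod_atTop_atTop_eq]; exact tendsto_fst)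
  have herr2 : Tendsto (fun m : ℕ × ℕ => ‖((u (σ m.2) : L2Pair Ω) - p (σ m.2)).fst‖ₑ) atTop
      (𝓝 0) := herr.comp (by rw [← prod_atTop_atTop_eq]; exact tendsto_snd)
  have hsum := (herr1.add hφlim).add herr2
  simp only [add_zero] at hsum
  refine tendsto_of_tendsto_of_tendsto_of_le_of_le tendsto_const_nhds hsum
    (fun _ => bot_le) fun m => ?_
  have h1 : eLpNorm (φ (σ m.1) - φ (σ m.2)) 2 volume = ‖(p (σ m.1) - p (σ m.2)).fst‖ₑ := by
    rw [WithLp.sub_fst, Lp.enorm_def, eLpNorm_congr_ae (Lp.coeFn_sub (p (σ m.1)).fst (p (σ m.2)).fst),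
      eLpNorm_congr_ae ((e1 (σ m.1)).sub (e1 (σ m.2))), eLpNorm_restrict_eq_of_support_subset]
    refine (Function.support_sub _ _).trans (Set.union_subset ?_ ?_)
    · exact (subset_tsupport _).trans (hφ _).subset
    · exact (subset_tsupport _).trans (hφ _).subset
  have h2 : eLpNorm (val (u (σ m.1) - u (σ m.2))) 2 (volume.restrict Ω) =
      ‖((u (σ m.1) : L2Pair Ω) - u (σ m.2)).fst‖ₑ := (Lp.enorm_def _).symm
  have h3 : ((u (σ m.1) : L2Pair Ω) - u (σ m.2)).fst =
      ((u (σ m.1) : L2Pair Ω) - p (σ m.1)).fst + (p (σ m.1) - p (σ m.2)).fst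
        - ((u (σ m.2) : L2Pair Ω) - p (σ m.2)).fst := by
    simp only [WithLp.sub_fst]; abel
  dsimp only
  rw [h2, h3, h1]
  refine enorm_sub_le.trans ?_
  gcongr
  exact enorm_add_le _ _

/-- The embedding of `H_0^1(Ω)` in `L^γ(Ω)`, `1 < γ ≤ 4`, is compact. -/
theorem exists_subseq_tendsto_gammaNorm {Ω : Set E3} (hΩ : Bornology.IsBounded Ω) {γ : ℝ}
    (hγ : 1 < γ) (hγ4 : γ ≤ 4) {u : ℕ → H01 Ω} (hu : ∀ n, ‖gradCLM Ω (u n)‖ ≤ 1) :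
    ∃ σ : ℕ → ℕ, StrictMono σ ∧
      Tendsto (fun p : ℕ × ℕ => (gammaNorm γ (u (σ p.1) - u (σ p.2))).toReal) atTop (𝓝 0) := by
  obtain ⟨σ, hσ, hlim⟩ := exists_subseq_tendsto_val hΩ hu
  refine ⟨σ, hσ, ?_⟩
  have h0 : (0 : ℝ) < γ - 1 := by linarith
  set K : ℝ≥0∞ := ↑(eLpNormLESNormFDerivOfLeConst ℝ (volume : Measure E3) Ω 2
    (2 * (γ - 1)).toNNReal) with hK
  set D : ℝ≥0∞ := (K * 2) ^ (γ - 1) with hD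
  have hDtop : D ≠ ⊤ := ENNReal.rpow_ne_top_of_nonneg h0.le
    (ENNReal.mul_ne_top (by simp [hK]) (by simp))
  have hle : ∀ p : ℕ × ℕ, gammaNorm γ (u (σ p.1) - u (σ p.2)) ≤
      (eLpNorm (val (u (σ p.1) - u (σ p.2))) 2 (volume.restrict Ω) * D) ^ (1 / γ) := by
    intro p
    set w := u (σ p.1) - u (σ p.2) with hw
    have h1 := eLpNorm_rpow_le_mul (aestronglyMeasurable_val w) hγ
    have h2 : gradNorm w ≤ 2 := by
      rw [← ENNReal.ofReal_toReal (gradNorm_ne_top w), ← norm_gradCLM]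
      refine (ENNReal.ofReal_le_ofReal ?_).trans_eq (by simp : ENNReal.ofReal 2 = 2)
      rw [hw, map_sub]
      refine (norm_sub_le _ _).trans ?_
      linarith [hu (σ p.1), hu (σ p.2)]
    -- Here `γ ≤ 4` matters: it is exactly `2 (γ - 1) ≤ 6`.
    have h3 : eLpNorm (val w) (ENNReal.ofReal (2 * (γ - 1))) (volume.restrict Ω) ≤ K * 2 :=
      (gammaNorm_le hΩ (γ := 2 * (γ - 1)) (by linarith) (by linarith) w).trans (by gcongr)
    have h4 : gammaNorm γ w = (gammaNorm γ w ^ γ) ^ (1 / γ) := by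
      rw [← ENNReal.rpow_mul, mul_one_div_cancel (by linarith), ENNReal.rpow_one]
    rw [h4]
    refine ENNReal.rpow_le_rpow (h1.trans ?_) (by positivity)
    exact mul_le_mul_right (ENNReal.rpow_le_rpow h3 h0.le) _
  have hz : Tendsto (fun p : ℕ × ℕ =>
      (eLpNorm (val (u (σ p.1) - u (σ p.2))) 2 (volume.restrict Ω) * D) ^ (1 / γ)) atTop
        (𝓝 0) := by
    have h1 := ENNReal.Tendsto.mul_const (b := D) hlim (Or.inr hDtop)
    rw [zero_mul] at h1
    have h2 := ((ENNReal.continuous_rpow_const (y := 1 / γ)).tendsto 0).comp h1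
    have h3 : (0 : ℝ≥0∞) ^ (1 / γ) = 0 := ENNReal.zero_rpow_of_pos (by positivity)
    rw [h3] at h2
    exact h2
  have h5 := tendsto_of_tendsto_of_tendsto_of_le_of_le tendsto_const_nhds hz
    (fun _ => bot_le) hle
  simpa [Function.comp_def] using (ENNReal.tendsto_toReal (by simp : (0 : ℝ≥0∞) ≠ ⊤)).comp h5

/-- A bump function equal to 1 at a point of `Ω` works: if it vanished almost everywhere on the open
set `Ω`, continuity would make it vanish at that point. -/
theorem exists_H01_ne_zero {Ω : Set E3} (hΩo : IsOpen Ω) (hΩn : Ω.Nonempty) :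
    ∃ u : H01 Ω, u ≠ 0 := by
  obtain ⟨x, hx⟩ := hΩn
  obtain ⟨φ, hφs, hφc, hφsm, -, hφx⟩ := exists_contDiff_tsupport_subset (n := ⊤)
    (hΩo.mem_nhds hx)
  have hφ : IsTestFunction Ω φ := ⟨hφsm, hφc, hφs⟩
  have m1 : MemLp φ 2 (volume.restrict Ω) :=
    (hφsm.continuous.memLp_of_hasCompactSupport hφc).restrict Ω
  have hgc : Continuous (gradient φ) :=
    (InnerProductSpace.toDual ℝ E3).symm.continuous.comp (hφsm.continuous_fderiv (by simp))
  have hgs : HasCompactSupport (gradient φ) :=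
    (hφc.fderiv (𝕜 := ℝ)).comp_left (g := (InnerProductSpace.toDual ℝ E3).symm) (map_zero _)
  have m2 : MemLp (gradient φ) 2 (volume.restrict Ω) :=
    (hgc.memLp_of_hasCompactSupport hgs).restrict Ω
  let p : L2Pair Ω := WithLp.toLp 2 (m1.toLp, m2.toLp)
  have hp : p ∈ testPairs Ω := ⟨φ, hφ, m1.coeFn_toLp, m2.coeFn_toLp⟩
  refine ⟨⟨p, subset_closure hp⟩, fun h => ?_⟩
  have h1 : p.fst = 0 := by
    have : p = 0 := congrArg Subtype.val h
    rw [this]; rfl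
  have h2 : φ =ᵐ[volume.restrict Ω] 0 :=
    m1.coeFn_toLp.symm.trans ((by rw [show m1.toLp = 0 from h1] :
      (m1.toLp : E3 → ℝ) =ᵐ[volume.restrict Ω] (0 : Lp ℝ 2 (volume.restrict Ω))).trans
        (Lp.coeFn_zero _ _ _))
  have h3 := Measure.eqOn_open_of_ae_eq h2 hΩo hφsm.continuous.continuousOn continuousOn_const hx
  rw [hφx] at h3
  simp at h3

/-- The quotient `‖u‖_γ / ‖u‖` attains its maximum on `H_0^1(Ω) \ {0}`. -/
theorem exists_maximizer {Ω : Set E3} (hΩo : IsOpen Ω) (hΩ : Bornology.IsBounded Ω)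
    (hΩn : Ω.Nonempty) {γ : ℝ} (hγ : 1 < γ) (hγ4 : γ ≤ 4) :
    ∃ u : H01 Ω, u ≠ 0 ∧ ∀ v : H01 Ω, v ≠ 0 →
      gammaNorm γ v / gradNorm v ≤ gammaNorm γ u / gradNorm u := by
  have hcomplete : CompleteSpace (H01 Ω) :=
    (Submodule.isClosed_topologicalClosure _).completeSpace_coe
  have hγ6 : γ ≤ 6 := by linarith
  have hγ0 : 0 < γ := by linarith
  set K := eLpNormLESNormFDerivOfLeConst ℝ (volume : Measure E3) Ω 2 2 with hK
  obtain ⟨w, hw⟩ := exists_H01_ne_zero hΩo hΩn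
  obtain ⟨u, hu1, hu⟩ := exists_maximizer_of_compact (gradCLM Ω) (gammaSeminorm hΩ hγ.le hγ6)
    -- `K` bounds the `L²` norm of the function by Poincaré's inequality, and the 1 accounts for the
    -- gradient itself.
    (C := K + 1) (c := eLpNormLESNormFDerivOfLeConst ℝ (volume : Measure E3) Ω 2 γ.toNNReal)
    (fun u => by
      have h1 := eLpNorm_val_le hΩ (q := 2) (by simp) (by norm_num) u
      have h2 := ENNReal.toReal_mono (ENNReal.mul_ne_top (by simp) (gradNorm_ne_top u)) h1
      rw [ENNReal.toReal_mul, ← norm_gradCLM] at h2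
      have h3 : ‖(u : L2Pair Ω).fst‖ ≤ K * ‖(u : L2Pair Ω).snd‖ := by
        rw [Lp.norm_def]; exact h2
      have h4 : ‖u‖ ≤ ‖(u : L2Pair Ω).fst‖ + ‖(u : L2Pair Ω).snd‖ := by
        change ‖(u : L2Pair Ω)‖ ≤ _
        rw [WithLp.prod_norm_eq_of_L2]
        refine Real.sqrt_le_iff.2 ⟨by positivity, ?_⟩
        nlinarith [norm_nonneg (u : L2Pair Ω).fst, norm_nonneg (u : L2Pair Ω).snd]
      change ‖u‖ ≤ (K + 1) * ‖(u : L2Pair Ω).snd‖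
      linarith)
    (fun u => by
      rw [norm_gradCLM]
      have h2 := ENNReal.toReal_mono (ENNReal.mul_ne_top (by simp) (gradNorm_ne_top u))
        (gammaNorm_le hΩ hγ0 hγ6 u)
      rwa [ENNReal.toReal_mul] at h2)
    ⟨w, ENNReal.toReal_ne_zero.2 ⟨gammaNorm_ne_zero hΩo hγ0 hw, gammaNorm_ne_top hΩ hγ0 hγ6 w⟩⟩
    (fun v hv => exists_subseq_tendsto_gammaNorm hΩ hγ hγ4 hv)
  have hu0 : u ≠ 0 := by
    rintro rfl
    simp at hu1
  have hgu : gradNorm u = 1 := by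
    rw [norm_gradCLM, ENNReal.toReal_eq_one_iff] at hu1
    exact hu1
  refine ⟨u, hu0, fun v hv => ?_⟩
  rw [hgu, div_one]
  refine ENNReal.div_le_of_le_mul ?_
  have h1 : (gammaNorm γ v).toReal ≤ (gammaNorm γ u).toReal * ‖gradCLM Ω v‖ := hu v
  rw [norm_gradCLM, ← ENNReal.toReal_mul] at h1
  exact (ENNReal.toReal_le_toReal (gammaNorm_ne_top hΩ hγ0 hγ6 v)
    (ENNReal.mul_ne_top (gammaNorm_ne_top hΩ hγ0 hγ6 u) (gradNorm_ne_top v))).1 h1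

/-! ### The fiber map and its derivatives. -/

theorem integral_norm_grad_sq {Ω : Set E3} (u : H01 Ω) :
    ∫ x in Ω, ‖grad u x‖ ^ 2 = (gradNorm u).toReal ^ 2 := by
  have hm : MemLp (grad u) 2 (volume.restrict Ω) := Lp.memLp _
  have h := hm.eLpNorm_eq_integral_rpow_norm (by simp) (by simp)
  have h0 : 0 ≤ ∫ x in Ω, ‖grad u x‖ ^ 2 := integral_nonneg fun _ => by positivity
  unfold gradNorm
  rw [h]
  simp only [ENNReal.toReal_ofNat, Real.rpow_two]
  rw [ENNReal.toReal_ofReal (by positivity), ← Real.rpow_natCast, ← Real.rpow_mul h0]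
  norm_num

theorem integral_abs_val_rpow {Ω : Set E3} (hΩ : Bornology.IsBounded Ω) {γ : ℝ} (hγ : 0 < γ)
    (hγ6 : γ ≤ 6) (u : H01 Ω) :
    ∫ x in Ω, |val u x| ^ γ = (gammaNorm γ u).toReal ^ γ := by
  have hm : MemLp (val u) (ENNReal.ofReal γ) (volume.restrict Ω) :=
    ⟨aestronglyMeasurable_val u, (gammaNorm_ne_top hΩ hγ hγ6 u).lt_top⟩
  have h := hm.eLpNorm_eq_integral_rpow_norm (by simpa using hγ) (by simp)
  have h0 : 0 ≤ ∫ x in Ω, |val u x| ^ γ := integral_nonneg fun _ => by positivity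
  unfold gammaNorm
  rw [h]
  simp only [ENNReal.toReal_ofReal hγ.le, Real.norm_eq_abs]
  rw [ENNReal.toReal_ofReal (by positivity), ← Real.rpow_mul h0, inv_mul_cancel₀ hγ.ne',
    Real.rpow_one]

theorem fiber_eq {Ω : Set E3} (a γ l : ℝ) (u : H01 Ω) {t : ℝ} (ht : 0 < t) :
    fiber a γ l u t = a / 2 * (∫ x in Ω, ‖grad u x‖ ^ 2) * t ^ 2
      + l / 4 * (∫ x in Ω, ‖grad u x‖ ^ 2) ^ 2 * t ^ 4
      - 1 / γ * (∫ x in Ω, |val u x| ^ γ) * t ^ γ := by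
  have h1 : ∫ x in Ω, ‖grad (t • u) x‖ ^ 2 = t ^ 2 * ∫ x in Ω, ‖grad u x‖ ^ 2 := by
    rw [← integral_const_mul]
    refine integral_congr_ae ?_
    filter_upwards [grad_smul t u] with x hx
    rw [hx, Pi.smul_apply, norm_smul, mul_pow, Real.norm_eq_abs, sq_abs]
  have h2 : ∫ x in Ω, |val (t • u) x| ^ γ = t ^ γ * ∫ x in Ω, |val u x| ^ γ := by
    rw [← integral_const_mul]
    refine integral_congr_ae ?_
    filter_upwards [val_smul t u] with x hx
    rw [hx, Pi.smul_apply, smul_eq_mul, abs_mul, abs_of_pos ht,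
      Real.mul_rpow ht.le (abs_nonneg _)]
  unfold fiber energy
  rw [h1, h2]
  ring

theorem deriv_fiber {Ω : Set E3} (a γ l : ℝ) (hγ : γ ≠ 0) (u : H01 Ω) {t : ℝ} (ht : 0 < t) :
    deriv (fiber a γ l u) t = a * (∫ x in Ω, ‖grad u x‖ ^ 2) * t
      + l * (∫ x in Ω, ‖grad u x‖ ^ 2) ^ 2 * t ^ 3
      - (∫ x in Ω, |val u x| ^ γ) * t ^ (γ - 1) := by
  have he : fiber a γ l u =ᶠ[𝓝 t] fun t => a / 2 * (∫ x in Ω, ‖grad u x‖ ^ 2) * t ^ 2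
      + l / 4 * (∫ x in Ω, ‖grad u x‖ ^ 2) ^ 2 * t ^ 4
      - 1 / γ * (∫ x in Ω, |val u x| ^ γ) * t ^ γ := by
    filter_upwards [lt_mem_nhds ht] with s hs
    exact fiber_eq a γ l u hs
  rw [he.deriv_eq]
  have h := (((hasDerivAt_pow 2 t).const_mul (a / 2 * (∫ x in Ω, ‖grad u x‖ ^ 2))).add
    ((hasDerivAt_pow 4 t).const_mul (l / 4 * (∫ x in Ω, ‖grad u x‖ ^ 2) ^ 2))).sub
    ((Real.hasDerivAt_rpow_const (p := γ) (Or.inl ht.ne')).const_mul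
      (1 / γ * (∫ x in Ω, |val u x| ^ γ)))
  refine h.deriv.trans ?_
  field_simp
  norm_num
  ring

theorem deriv_deriv_fiber {Ω : Set E3} (a γ l : ℝ) (hγ : γ ≠ 0) (u : H01 Ω) {t : ℝ} (ht : 0 < t) :
    deriv (deriv (fiber a γ l u)) t = a * (∫ x in Ω, ‖grad u x‖ ^ 2)
      + 3 * l * (∫ x in Ω, ‖grad u x‖ ^ 2) ^ 2 * t ^ 2
      - (γ - 1) * (∫ x in Ω, |val u x| ^ γ) * t ^ (γ - 2) := by
  have he : deriv (fiber a γ l u) =ᶠ[𝓝 t] fun t => a * (∫ x in Ω, ‖grad u x‖ ^ 2) * t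
      + l * (∫ x in Ω, ‖grad u x‖ ^ 2) ^ 2 * t ^ 3
      - (∫ x in Ω, |val u x| ^ γ) * t ^ (γ - 1) := by
    filter_upwards [lt_mem_nhds ht] with s hs
    exact deriv_fiber a γ l hγ u hs
  rw [he.deriv_eq]
  have h := (((hasDerivAt_id t).const_mul (a * (∫ x in Ω, ‖grad u x‖ ^ 2))).add
    ((hasDerivAt_pow 3 t).const_mul (l * (∫ x in Ω, ‖grad u x‖ ^ 2) ^ 2))).sub
    ((Real.hasDerivAt_rpow_const (p := γ - 1) (Or.inl ht.ne')).const_mul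
      (∫ x in Ω, |val u x| ^ γ))
  refine h.deriv.trans ?_
  rw [show γ - 1 - 1 = γ - 2 by ring]
  norm_num
  ring

/-! ### Constants and the two algebraic systems. -/

theorem rpow_eq_iff_eq_rpow_one_div {t x p : ℝ} (ht : 0 ≤ t) (hx : 0 ≤ x) (hp : 0 < p) :
    t ^ p = x ↔ t = x ^ (1 / p) := by
  constructor
  · rintro rfl
    rw [← Real.rpow_mul ht, mul_one_div_cancel hp.ne', Real.rpow_one]
  · rintro rfl
    rw [← Real.rpow_mul hx, one_div_mul_cancel hp.ne', Real.rpow_one]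

/-- Turns `1 / (A t²)` at a solution `t` into a power of `‖u‖_γ / ‖u‖`. It serves both systems, with
`κ = 2a/(4-γ)` and `κ = aγ/(4-γ)`. Taking logarithms reduces it to an identity linear in `log N`,
`log P`, `log κ`. -/
theorem one_div_mul_sq_rpow {N P κ γ : ℝ} (hN : 0 < N) (hP : 0 < P) (hκ : 0 < κ) (hγ : 2 < γ) :
    1 / (N ^ 2 * ((κ * (N ^ 2 / P ^ γ)) ^ (1 / (γ - 2))) ^ 2) =
      κ⁻¹ ^ (2 / (γ - 2)) * (P / N) ^ (2 * γ / (γ - 2)) := by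
  have h2 : 0 < γ - 2 := by linarith
  have hL : 0 < N ^ 2 * ((κ * (N ^ 2 / P ^ γ)) ^ (1 / (γ - 2))) ^ 2 := by positivity
  refine Real.log_injOn_pos (Set.mem_Ioi.2 (by positivity)) (Set.mem_Ioi.2 (by positivity)) ?_
  rw [one_div, Real.log_inv, Real.log_mul (by positivity) (by positivity), Real.log_pow,
    Real.log_pow, Real.log_rpow (by positivity), Real.log_mul (by positivity) (by positivity),
    Real.log_div (by positivity) (by positivity), Real.log_pow, Real.log_rpow hP,
    Real.log_mul (by positivity) (by positivity), Real.log_rpow (by positivity),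
    Real.log_rpow (by positivity), Real.log_inv, Real.log_div hP.ne' hN.ne']
  field_simp
  push_cast
  ring

theorem constC_pos {a γ : ℝ} (ha : 0 < a) (hγ2 : 2 < γ) (hγ4 : γ < 4) : 0 < constC a γ := by
  have h1 : 0 < γ - 2 := by linarith
  have h2 : 0 < 4 - γ := by linarith
  unfold constC
  positivity

theorem constC0_pos {γ : ℝ} (hγ : 0 < γ) : 0 < constC0 γ := by
  unfold constC0
  positivity

/-- Equivalent to `2^s < 1 + s` with `s = (γ-2)/2`, which is strict Bernoulli for an exponent in
`(0, 1)`. -/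
theorem constC0_lt_one {γ : ℝ} (hγ2 : 2 < γ) (hγ4 : γ < 4) : constC0 γ < 1 := by
  have h1 : 0 < γ - 2 := by linarith
  have hB : (1 + 1 : ℝ) ^ ((γ - 2) / 2) < 1 + (γ - 2) / 2 * 1 :=
    rpow_one_add_lt_one_add_mul_self (by norm_num) (by norm_num) (by linarith) (by linarith)
  have h2 : (2 : ℝ) < (γ / 2) ^ (2 / (γ - 2)) := by
    have h3 : ((1 + 1 : ℝ) ^ ((γ - 2) / 2)) ^ (2 / (γ - 2)) < (γ / 2) ^ (2 / (γ - 2)) :=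
      Real.rpow_lt_rpow (by positivity) (by linarith) (by positivity)
    rwa [← Real.rpow_mul (by norm_num), div_mul_div_comm, mul_comm (γ - 2) 2,
      div_self (by positivity), Real.rpow_one, one_add_one_eq_two] at h3
  unfold constC0
  rw [← inv_div γ 2, Real.inv_rpow (by positivity), ← div_eq_mul_inv, div_lt_one (by positivity)]
  exact h2

theorem toReal_lam {Ω : Set E3} {a γ : ℝ} (hC : 0 ≤ constC a γ) (u : H01 Ω) :
    (lam a γ u).toReal = constC a γ *
      ((gammaNorm γ u).toReal / (gradNorm u).toReal) ^ (2 * γ / (γ - 2)) := by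
  unfold lam
  rw [ENNReal.toReal_mul, ENNReal.toReal_ofReal hC, ← ENNReal.toReal_rpow, ENNReal.toReal_div]

/-- The algebraic system `ψ' = ψ'' = 0`. -/
theorem critical_system_iff {a γ A G t l : ℝ} (ha : 0 < a) (hγ2 : 2 < γ) (hγ4 : γ < 4)
    (hA : 0 < A) (hG : 0 < G) (ht : 0 < t) :
    (0 < l ∧ a * A * t + l * A ^ 2 * t ^ 3 - G * t ^ (γ - 1) = 0 ∧
      a * A + 3 * l * A ^ 2 * t ^ 2 - (γ - 1) * G * t ^ (γ - 2) = 0) ↔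
    (t ^ (γ - 2) = 2 * a / (4 - γ) * (A / G) ∧
      l = a * ((γ - 2) / (4 - γ)) * (1 / (A * t ^ 2))) := by
  have h4 : 0 < 4 - γ := by linarith
  have h2 : 0 < γ - 2 := by linarith
  have e : t ^ (γ - 1) = t * t ^ (γ - 2) := by
    rw [← Real.rpow_one_add' ht.le (by linarith)]; congr 1; ring
  rw [e]
  set Y := t ^ (γ - 2)
  constructor
  · rintro ⟨-, h1, h3⟩
    have h1' : a * A + l * A ^ 2 * t ^ 2 - G * Y = 0 := by
      refine (mul_eq_zero.1 (?_ : t * _ = 0)).resolve_left ht.ne'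
      linarith
    -- Three times `h1'` minus `h3` eliminates `l` and leaves `2aA = (4-γ) G Y`.
    have hY : Y = 2 * a / (4 - γ) * (A / G) := by
      field_simp
      linarith
    refine ⟨hY, ?_⟩
    rw [hY] at h1'
    field_simp at h1' ⊢
    have : A * (l * A * t ^ 2 * (4 - γ) - a * (γ - 2)) = 0 := by linarith
    have := (mul_eq_zero.1 this).resolve_left hA.ne'
    linarith
  · rintro ⟨hY, rfl⟩
    rw [hY]
    refine ⟨by positivity, ?_, ?_⟩ <;> field_simp <;> ring

/-- The algebraic system `ψ = ψ' = 0`. -/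
theorem zero_system_iff {a γ A G t l : ℝ} (ha : 0 < a) (hγ2 : 2 < γ) (hγ4 : γ < 4)
    (hA : 0 < A) (hG : 0 < G) (ht : 0 < t) :
    (0 < l ∧ a / 2 * A * t ^ 2 + l / 4 * A ^ 2 * t ^ 4 - 1 / γ * G * t ^ γ = 0 ∧
      a * A * t + l * A ^ 2 * t ^ 3 - G * t ^ (γ - 1) = 0) ↔
    (t ^ (γ - 2) = a * γ / (4 - γ) * (A / G) ∧
      l = 2 * (a * ((γ - 2) / (4 - γ))) * (1 / (A * t ^ 2))) := by
  have h4 : 0 < 4 - γ := by linarith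
  have h2 : 0 < γ - 2 := by linarith
  have h0 : 0 < γ := by linarith
  have e : t ^ (γ - 1) = t * t ^ (γ - 2) := by
    rw [← Real.rpow_one_add' ht.le (by linarith)]; congr 1; ring
  have e' : t ^ γ = t ^ 2 * t ^ (γ - 2) := by
    rw [← Real.rpow_natCast t 2, ← Real.rpow_add ht]; congr 1; push_cast; ring
  rw [e, e']
  set Y := t ^ (γ - 2)
  constructor
  · rintro ⟨-, h3, h1⟩
    have h1' : a * A + l * A ^ 2 * t ^ 2 - G * Y = 0 := by
      refine (mul_eq_zero.1 (?_ : t * _ = 0)).resolve_left ht.ne'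
      linarith
    have h3' : a / 2 * A + l / 4 * A ^ 2 * t ^ 2 - 1 / γ * G * Y = 0 := by
      refine (mul_eq_zero.1 (?_ : t ^ 2 * _ = 0)).resolve_left (by positivity)
      linarith
    field_simp at h3'
    -- Four times `ψ/t²` minus `ψ'/t` eliminates `l` and leaves `aA = ((4-γ)/γ) G Y`.
    have hY : Y = a * γ / (4 - γ) * (A / G) := by
      field_simp
      linear_combination γ * h1' - 1 / 2 * h3'
    refine ⟨hY, ?_⟩
    rw [hY] at h1'
    field_simp at h1' ⊢
    have : A * (l * A * t ^ 2 * (4 - γ) - 2 * a * (γ - 2)) = 0 := by linarith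
    have := (mul_eq_zero.1 this).resolve_left hA.ne'
    linarith
  · rintro ⟨hY, rfl⟩
    rw [hY]
    refine ⟨by positivity, ?_, ?_⟩ <;> field_simp <;> ring

theorem toReal_gradNorm_pos {Ω : Set E3} (hΩo : IsOpen Ω) (hΩ : Bornology.IsBounded Ω)
    {u : H01 Ω} (hu : u ≠ 0) : 0 < (gradNorm u).toReal :=
  ENNReal.toReal_pos (gradNorm_ne_zero hΩo hΩ hu) (gradNorm_ne_top u)

theorem toReal_gammaNorm_pos {Ω : Set E3} (hΩo : IsOpen Ω) (hΩ : Bornology.IsBounded Ω) {γ : ℝ}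
    (hγ : 0 < γ) (hγ6 : γ ≤ 6) {u : H01 Ω} (hu : u ≠ 0) : 0 < (gammaNorm γ u).toReal :=
  ENNReal.toReal_pos (gammaNorm_ne_zero hΩo hγ hu) (gammaNorm_ne_top hΩ hγ hγ6 u)

theorem deriv_fiber_eq_zero_iff {Ω : Set E3} (hΩo : IsOpen Ω) (hΩ : Bornology.IsBounded Ω)
    {a γ : ℝ} (ha : 0 < a) (hγ2 : 2 < γ) (hγ4 : γ < 4) {u : H01 Ω} (hu : u ≠ 0) (t l : ℝ) :
    (0 < t ∧ 0 < l ∧ deriv (fiber a γ l u) t = 0 ∧ deriv (deriv (fiber a γ l u)) t = 0) ↔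
      (t = tOf a γ u ∧ l = (lam a γ u).toReal) := by
  have h4 : 0 < 4 - γ := by linarith
  have h2 : 0 < γ - 2 := by linarith
  have hγ0 : 0 < γ := by linarith
  have hγ6 : γ ≤ 6 := by linarith
  have hN := toReal_gradNorm_pos hΩo hΩ hu
  have hP := toReal_gammaNorm_pos hΩo hΩ hγ0 hγ6 hu
  have ht0 : 0 < tOf a γ u := by
    unfold tOf
    rw [integral_norm_grad_sq, integral_abs_val_rpow hΩ hγ0 hγ6]
    positivity
  have hl : a * ((γ - 2) / (4 - γ)) * (1 / ((gradNorm u).toReal ^ 2 * tOf a γ u ^ 2)) =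
      (lam a γ u).toReal := by
    rw [toReal_lam (constC_pos ha hγ2 hγ4).le]
    unfold tOf constC
    rw [integral_norm_grad_sq, integral_abs_val_rpow hΩ hγ0 hγ6,
      one_div_mul_sq_rpow hN hP (by positivity) hγ2, inv_div, mul_assoc _ (_ ^ _) (_ ^ _)]
  have key : ∀ s, 0 < s → (s ^ (γ - 2) = 2 * a / (4 - γ) *
      ((gradNorm u).toReal ^ 2 / (gammaNorm γ u).toReal ^ γ) ↔ s = tOf a γ u) := by
    intro s hs
    unfold tOf
    rw [rpow_eq_iff_eq_rpow_one_div hs.le (by positivity) h2, integral_norm_grad_sq,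
      integral_abs_val_rpow hΩ hγ0 hγ6]
  have main : ∀ s, 0 < s →
      ((0 < l ∧ deriv (fiber a γ l u) s = 0 ∧ deriv (deriv (fiber a γ l u)) s = 0) ↔
        (s = tOf a γ u ∧ l = a * ((γ - 2) / (4 - γ)) * (1 / ((gradNorm u).toReal ^ 2 * s ^ 2)))) := by
    intro s hs
    rw [deriv_fiber a γ l hγ0.ne' u hs, deriv_deriv_fiber a γ l hγ0.ne' u hs,
      integral_norm_grad_sq, integral_abs_val_rpow hΩ hγ0 hγ6,
      critical_system_iff ha hγ2 hγ4 (by positivity) (by positivity) hs, key s hs]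
  constructor
  · rintro ⟨ht, h⟩
    obtain ⟨rfl, h'⟩ := (main t ht).1 h
    exact ⟨rfl, h'.trans hl⟩
  · rintro ⟨rfl, h'⟩
    exact ⟨ht0, (main _ ht0).2 ⟨rfl, h'.trans hl.symm⟩⟩

theorem exists_fiber_eq_zero_iff {Ω : Set E3} (hΩo : IsOpen Ω) (hΩ : Bornology.IsBounded Ω)
    {a γ : ℝ} (ha : 0 < a) (hγ2 : 2 < γ) (hγ4 : γ < 4) {u : H01 Ω} (hu : u ≠ 0) :
    ∃ t₀ : ℝ, ∀ t l : ℝ,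
      (0 < t ∧ 0 < l ∧ fiber a γ l u t = 0 ∧ deriv (fiber a γ l u) t = 0) ↔
        (t = t₀ ∧ l = (lam0 a γ u).toReal) := by
  have h4 : 0 < 4 - γ := by linarith
  have h2 : 0 < γ - 2 := by linarith
  have hγ0 : 0 < γ := by linarith
  have hγ6 : γ ≤ 6 := by linarith
  have hN := toReal_gradNorm_pos hΩo hΩ hu
  have hP := toReal_gammaNorm_pos hΩo hΩ hγ0 hγ6 hu
  set N := (gradNorm u).toReal with hNdef
  set P := (gammaNorm γ u).toReal with hPdef
  set t₀ : ℝ := (a * γ / (4 - γ) * (N ^ 2 / P ^ γ)) ^ (1 / (γ - 2)) with ht₀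
  have ht0 : 0 < t₀ := by positivity
  have hl : 2 * (a * ((γ - 2) / (4 - γ))) * (1 / (N ^ 2 * t₀ ^ 2)) = (lam0 a γ u).toReal := by
    unfold lam0
    rw [ENNReal.toReal_mul, ENNReal.toReal_ofReal (constC0_pos hγ0).le,
      toReal_lam (constC_pos ha hγ2 hγ4).le, ht₀, one_div_mul_sq_rpow hN hP (by positivity) hγ2]
    unfold constC constC0
    -- The factor `2/γ` is all that distinguishes this `κ⁻¹` from the one behind `λ(u)`; its power,
    -- with the 2 in front, is `constC0 γ`.
    rw [show (a * γ / (4 - γ))⁻¹ = 2 / γ * ((4 - γ) / (2 * a)) by field_simp,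
      Real.mul_rpow (by positivity) (by positivity)]
    ring
  have main : ∀ s l, 0 < s → ((0 < l ∧ fiber a γ l u s = 0 ∧ deriv (fiber a γ l u) s = 0) ↔
      (s = t₀ ∧ l = 2 * (a * ((γ - 2) / (4 - γ))) * (1 / (N ^ 2 * s ^ 2)))) := by
    intro s l hs
    rw [deriv_fiber a γ l hγ0.ne' u hs, fiber_eq a γ l u hs, integral_norm_grad_sq,
      integral_abs_val_rpow hΩ hγ0 hγ6,
      zero_system_iff ha hγ2 hγ4 (by positivity) (by positivity) hs,
      rpow_eq_iff_eq_rpow_one_div hs.le (by positivity) h2]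
  refine ⟨t₀, fun t l => ⟨?_, ?_⟩⟩
  · rintro ⟨ht, h⟩
    obtain ⟨rfl, h'⟩ := (main t l ht).1 h
    exact ⟨rfl, h'.trans hl⟩
  · rintro ⟨rfl, h'⟩
    exact ⟨ht0, (main _ l ht0).2 ⟨rfl, h'.trans hl.symm⟩⟩

end Kirchhoff

end

/-! ### The theorem, read off at one maximizer. -/

open Kirchhoff

theorem mainTheorem3 (Ω : Set Kirchhoff.E3) (hΩo : IsOpen Ω) (hΩb : Bornology.IsBounded Ω)
    (hΩn : Ω.Nonempty) (a γ : ℝ) (ha : 0 < a) (hγ2 : 2 < γ) (hγ4 : γ < 4) :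
    -- the pair `(t(u), λ(u))` is the only solution of `ψ' = ψ'' = 0`
    (∀ u : Kirchhoff.H01 Ω, u ≠ 0 → ∀ t l : ℝ,
      (0 < t ∧ 0 < l ∧ deriv (Kirchhoff.fiber a γ l u) t = 0 ∧
        deriv (deriv (Kirchhoff.fiber a γ l u)) t = 0) ↔
      (t = Kirchhoff.tOf a γ u ∧ l = (Kirchhoff.lam a γ u).toReal)) ∧
    -- `λ₀(u)` is the second entry of the only solution of `ψ = ψ' = 0`
    (∀ u : Kirchhoff.H01 Ω, u ≠ 0 → ∃ t₀ : ℝ, ∀ t l : ℝ,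
      (0 < t ∧ 0 < l ∧ Kirchhoff.fiber a γ l u t = 0 ∧
        deriv (Kirchhoff.fiber a γ l u) t = 0) ↔
      (t = t₀ ∧ l = (Kirchhoff.lam0 a γ u).toReal)) ∧
    -- `λ*` in terms of the best constant of the embedding
    (0 < Kirchhoff.bestConst Ω γ ∧ Kirchhoff.bestConst Ω γ < ⊤ ∧
      Kirchhoff.lamStar Ω a γ =
        ENNReal.ofReal (Kirchhoff.constC a γ) *
          Kirchhoff.bestConst Ω γ ^ (2 * γ / (2 - γ))) ∧
    Kirchhoff.lam0Star Ω a γ < Kirchhoff.lamStar Ω a γ ∧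
    Kirchhoff.lamStar Ω a γ < ⊤ ∧
    ∃ u : Kirchhoff.H01 Ω, u ≠ 0 ∧
      Kirchhoff.lam a γ u = Kirchhoff.lamStar Ω a γ ∧
      Kirchhoff.lam0 a γ u = Kirchhoff.lam0Star Ω a γ := by
  have h2 : 0 < γ - 2 := by linarith
  have hγ0 : 0 < γ := by linarith
  have hγ6 : γ ≤ 6 := by linarith
  have he : 0 < 2 * γ / (γ - 2) := by positivity
  obtain ⟨w, hw, hmax⟩ := exists_maximizer hΩo hΩb hΩn (by linarith : 1 < γ) hγ4.le
  have hG0 := gammaNorm_ne_zero hΩo hγ0 hw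
  have hGt := gammaNorm_ne_top hΩb hγ0 hγ6 w
  have hN0 := gradNorm_ne_zero hΩo hΩb hw
  have hNt := gradNorm_ne_top w
  have hlam : ∀ v : H01 Ω, v ≠ 0 → lam a γ v ≤ lam a γ w := fun v hv =>
    mul_le_mul_right (ENNReal.rpow_le_rpow (hmax v hv) he.le) _
  have hstar : lamStar Ω a γ = lam a γ w :=
    le_antisymm (iSup_le fun v => hlam v.1 v.2)
      (le_iSup (fun v : {v : H01 Ω // v ≠ 0} => lam a γ v.1) ⟨w, hw⟩)
  have hstar0 : lam0Star Ω a γ = lam0 a γ w :=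
    le_antisymm (iSup_le fun v => mul_le_mul_right (hlam v.1 v.2) _)
      (le_iSup (fun v : {v : H01 Ω // v ≠ 0} => lam0 a γ v.1) ⟨w, hw⟩)
  have hbest : bestConst Ω γ = gradNorm w / gammaNorm γ w := by
    refine le_antisymm (iInf_le (fun v : {v : H01 Ω // v ≠ 0} =>
      gradNorm v.1 / gammaNorm γ v.1) ⟨w, hw⟩) (le_iInf fun v => ?_)
    have h := ENNReal.inv_le_inv.2 (hmax v.1 v.2)
    rwa [ENNReal.inv_div (Or.inl hNt) (Or.inl hN0),
      ENNReal.inv_div (Or.inl (gradNorm_ne_top _)) (Or.inl (gradNorm_ne_zero hΩo hΩb v.2))] at h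
  have hlamt : lam a γ w < ⊤ :=
    ENNReal.mul_lt_top (by simp) (ENNReal.rpow_lt_top_of_nonneg he.le (ENNReal.div_ne_top hGt hN0))
  have hlam0 : lam a γ w ≠ 0 := by
    refine mul_ne_zero (by simpa using constC_pos ha hγ2 hγ4) ?_
    exact (ENNReal.rpow_pos (ENNReal.div_pos hG0 hNt) (ENNReal.div_ne_top hGt hN0)).ne'
  refine ⟨fun u hu => deriv_fiber_eq_zero_iff hΩo hΩb ha hγ2 hγ4 hu,
    fun u hu => exists_fiber_eq_zero_iff hΩo hΩb ha hγ2 hγ4 hu, ⟨?_, ?_, ?_⟩, ?_, ?_,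
    w, hw, hstar.symm, hstar0.symm⟩
  · rw [hbest]
    exact ENNReal.div_pos hN0 hGt
  · rw [hbest]
    exact ENNReal.div_lt_top hNt hG0
  -- The best constant is the inverse of the maximal quotient, hence the change from `γ - 2` to `2 -
  -- γ` in the exponent.
  · rw [hstar, hbest, ← ENNReal.inv_div (Or.inl hNt) (Or.inl hN0), ← ENNReal.rpow_neg_one,
      ← ENNReal.rpow_mul]
    unfold lam
    congr 2
    rw [← neg_sub γ 2, div_neg]
    ring
  · rw [hstar0, hstar]
    -- Multiplication in `ℝ≥0∞` preserves the strict inequality only because `lam a γ w` is neither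
    -- 0 nor `⊤`.
    calc lam0 a γ w < 1 * lam a γ w := by
          refine ENNReal.mul_lt_mul_left hlam0 hlamt.ne ?_
          simpa using constC0_lt_one hγ2 hγ4
      _ = lam a γ w := one_mul _
  · rwa [hstar]
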